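/- Let $k$ be a field and let $C$ be a (coassociative, counital) cocommutative coalgebra over $k$, with comultiplication $\mu$ and counit $\epsilon$, endowed with a coaugmentation, i.e. a homomorphism of counital coalgebras $\gamma\colon k\to C$. Assume that $C$ is conilpotent: for every element $d$ of the noncounital coalgebra $D=C/\gamma(k)$ there is $n\ge 1$ such that the iterated comultiplication $\mu^{(n)}\colon D\to D^{\otimes n+1}$ annihilates $d$. Assume also that $C$ is finitely cogenerated: the $k$-vector space $\mathrm{Ext}^1_C(k,k)$, computed in the abelian category of left $C$-comodules, is finite-dimensional, where $k$ is viewed as a left $C$-comodule via $\gamma$. Let $C^*=\mathrm{Hom}_k(C,k)$ be the dual algebra, with multiplication $(fg)(c)=f(c_{(2)})g(c_{(1)})$ and unit $\epsilon$. Every left $C$-comodule $M$ is a $C^*$-module via $C^*\otimes_k M\to C^*\otimes_k C\otimes_k M\to M$; this defines the comodule inclusion functor $\Upsilon\colon C\text{-}\mathsf{Comod}\to C^*\text{-}\mathsf{Mod}$. A left $C$-contramodule is a $k$-vector space $P$ with a contraassociative and contraunital $k$-linear contraaction map $\pi\colon \mathrm{Hom}_k(C,P)\to P$; it is a $C^*$-module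 via $C^*\otimes_k P\to\mathrm{Hom}_k(C,P)\xrightarrow{\pi}P$; this defines the contramodule forgetful functor $\Theta\colon C\text{-}\mathsf{Contra}\to C^*\text{-}\mathsf{Mod}$. For an ideal $I$ in a commutative ring $R$, an $R$-module $M$ is called $I$-torsion if for all $s\in I$ and $x\in M$ there is $n\ge1$ with $s^nx=0$, and an $R$-module $P$ is called an $I$-contramodule if $\mathrm{Hom}_R(R[s^{-1}],P)=0=\mathrm{Ext}^1_R(R[s^{-1}],P)$ for all $s\in I$. Then $C^*$ is a Noetherian commutative local ring, complete and separated in the adic topology of its maximal ideal $I$, and: (a) the essential image of $\Upsilon$ coincides with the full subcategory $C^*\text{-}\mathsf{Mod}_{I\text{-tors}}\subset C^*\text{-}\mathsf{Mod}$ of $I$-torsion $C^*$-modules, and $\Upsilon$ induces a category equivalence $C\text{-}\mathsf{Comod}\simeq C^*\text{-}\mathsf{Mod}_{I\text{-tors}}$; (b) the functor $\Theta$ is fully faithful, its essential image coincides with the full subcategory $C^*\text{-}\mathsf{Mod}_{I\text{-ctra}}\subset C^*\text{-}\mathsf{Mod}$ of $I$-contramodule $C^*$-modules, and $\Theta$ induces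 a category equivalence $C\text{-}\mathsf{Contra}\simeq C^*\text{-}\mathsf{Mod}_{I\text{-ctra}}$. -/

import Mathlib

open CategoryTheory TensorProduct

universe u

/-! ### The dual algebra of a coalgebra -/

/-- The dual algebra `C* = Hom_k(C, k)` of a coalgebra, with the multiplication
`(f g)(c) = f (c₍₂₎) g (c₍₁₎)` and the unit `ε`: the opposite of the convolution algebra, whose
multiplication is `f (c₍₁₎) g (c₍₂₎)`. -/
abbrev DualAlgebra (k C : Type u) [Field k] [AddCommGroup C] [Module k C] [Coalgebra k C] :
    Type u :=
  (WithConv (C →ₗ[k] k))ᵐᵒᵖ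

/-- The linear functional underlying an element of the dual algebra. -/
def DualAlgebra.fn {k C : Type u} [Field k] [AddCommGroup C] [Module k C] [Coalgebra k C]
    (f : DualAlgebra k C) : C →ₗ[k] k :=
  f.unop.ofConv

section DualAlgebraLemmas

variable {k C : Type u} [Field k] [AddCommGroup C] [Module k C] [Coalgebra k C]

theorem DualAlgebra.fn_add (f g : DualAlgebra k C) : (f + g).fn = f.fn + g.fn := rfl

theorem DualAlgebra.fn_zero : (0 : DualAlgebra k C).fn = 0 := rfl

theorem DualAlgebra.fn_one : (1 : DualAlgebra k C).fn = Coalgebra.counit := by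
  ext c; rfl

theorem DualAlgebra.fn_mul (f g : DualAlgebra k C) :
    (f * g).fn = LinearMap.mul' k k ∘ₗ TensorProduct.map g.fn f.fn ∘ₗ Coalgebra.comul := rfl

end DualAlgebraLemmas

/-! ### Left comodules -/

/-- A (coassociative, counital) left comodule over the coalgebra `C`. -/
structure LeftComodule (k C : Type u) [Field k] [AddCommGroup C] [Module k C]
    [Coalgebra k C] where
  /-- the underlying vector space -/
  carrier : Type u
  [isAddCommGroup : AddCommGroup carrier]
  [isModule : Module k carrier]
  /-- the coaction `ν : M → C ⊗ M` -/
  coact : carrier →ₗ[k] C ⊗[k] carrier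
  coassoc : (TensorProduct.assoc k C C carrier).toLinearMap ∘ₗ
      LinearMap.rTensor carrier Coalgebra.comul ∘ₗ coact = LinearMap.lTensor C coact ∘ₗ coact
  counit_coact : (TensorProduct.lid k carrier).toLinearMap ∘ₗ
      LinearMap.rTensor carrier Coalgebra.counit ∘ₗ coact = LinearMap.id

namespace LeftComodule

attribute [instance] isAddCommGroup isModule

variable {k C : Type u} [Field k] [AddCommGroup C] [Module k C] [Coalgebra k C]

/-- Morphisms of left comodules: linear maps compatible with the coactions. -/
@[ext]
structure Hom (M N : LeftComodule k C) where
  /-- the underlying linear map -/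
  lin : M.carrier →ₗ[k] N.carrier
  comm : N.coact ∘ₗ lin = LinearMap.lTensor C lin ∘ₗ M.coact

/-- The category `C-Comod` of left `C`-comodules. -/
instance category : Category (LeftComodule k C) where
  Hom M N := Hom M N
  id M := ⟨LinearMap.id, by simp⟩
  comp f g := ⟨g.lin ∘ₗ f.lin, by
    rw [LinearMap.lTensor_comp, LinearMap.comp_assoc, ← f.comm, ← LinearMap.comp_assoc, g.comm,
      LinearMap.comp_assoc]⟩

/-- The linear map underlying a morphism of comodules. -/
abbrev linMap {M N : LeftComodule k C} (f : M ⟶ N) : M.carrier →ₗ[k] N.carrier := Hom.lin f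

theorem linMap_comm {M N : LeftComodule k C} (f : M ⟶ N) :
    N.coact ∘ₗ linMap f = LinearMap.lTensor C (linMap f) ∘ₗ M.coact := Hom.comm f

theorem linMap_injective {M N : LeftComodule k C} {f g : M ⟶ N} (h : linMap f = linMap g) :
    f = g := Hom.ext h

@[simp] theorem linMap_id (M : LeftComodule k C) : linMap (𝟙 M) = LinearMap.id := rfl

@[simp] theorem linMap_comp {L M N : LeftComodule k C} (f : L ⟶ M) (g : M ⟶ N) :
    linMap (f ≫ g) = linMap g ∘ₗ linMap f := rfl

/-! #### The dual algebra acts on left comodules -/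

/-- The action `f · m = f (m₍₋₁₎) m₍₀₎` of the dual algebra on a left comodule. -/
instance dualSMul (M : LeftComodule k C) : SMul (DualAlgebra k C) M.carrier where
  smul f m := TensorProduct.lid k M.carrier (LinearMap.rTensor M.carrier f.fn (M.coact m))

theorem dual_smul_def (M : LeftComodule k C) (f : DualAlgebra k C) (m : M.carrier) :
    f • m = TensorProduct.lid k M.carrier (LinearMap.rTensor M.carrier f.fn (M.coact m)) := rfl

theorem dual_mul_smul (M : LeftComodule k C) (f g : DualAlgebra k C) (m : M.carrier) :
    (f * g) • m = f • g • m := by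
  have h1 : ∀ t : C ⊗[k] M.carrier,
      TensorProduct.lid k M.carrier (LinearMap.rTensor M.carrier (f * g).fn t) =
        TensorProduct.lid k M.carrier (LinearMap.rTensor M.carrier f.fn
          (TensorProduct.lid k (C ⊗[k] M.carrier) (LinearMap.rTensor (C ⊗[k] M.carrier) g.fn
            (TensorProduct.assoc k C C M.carrier
              (LinearMap.rTensor M.carrier Coalgebra.comul t))))) := by
    intro t
    induction t using TensorProduct.induction_on with
    | zero => simp
    | add x y hx hy => simp only [map_add, hx, hy]
    | tmul c x =>
      rw [DualAlgebra.fn_mul]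
      simp only [LinearMap.rTensor_tmul, LinearMap.comp_apply, TensorProduct.lid_tmul]
      generalize (Coalgebra.comul (R := k) c) = d
      induction d using TensorProduct.induction_on with
      | zero => simp
      | add a b ha hb => simp only [map_add, add_smul, TensorProduct.add_tmul, ha, hb]
      | tmul a b => simp [mul_smul]
  have h2 : ∀ t : C ⊗[k] M.carrier,
      TensorProduct.lid k (C ⊗[k] M.carrier) (LinearMap.rTensor (C ⊗[k] M.carrier) g.fn
        (LinearMap.lTensor C M.coact t)) =
      M.coact (TensorProduct.lid k M.carrier (LinearMap.rTensor M.carrier g.fn t)) := by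
    intro t
    induction t using TensorProduct.induction_on with
    | zero => simp
    | add x y hx hy => simp only [map_add, hx, hy]
    | tmul c x => simp
  have h3 := LinearMap.congr_fun M.coassoc m
  simp only [LinearMap.comp_apply, LinearEquiv.coe_coe] at h3
  rw [dual_smul_def, h1, h3, h2]
  rfl

/-- The left `C*`-module structure on a left `C`-comodule. -/
instance dualModule (M : LeftComodule k C) : Module (DualAlgebra k C) M.carrier where
  one_smul m := by
    rw [dual_smul_def, DualAlgebra.fn_one]
    exact LinearMap.congr_fun M.counit_coact m
  mul_smul := dual_mul_smul M
  smul_zero f := by simp [dual_smul_def]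
  smul_add f x y := by simp [dual_smul_def]
  add_smul f g x := by simp [dual_smul_def, DualAlgebra.fn_add, LinearMap.rTensor_add]
  zero_smul x := by simp [dual_smul_def, DualAlgebra.fn_zero]

variable (k C) in
/-- The comodule inclusion functor `Υ : C-Comod ⥤ C*-Mod`. -/
noncomputable def upsilon : LeftComodule k C ⥤ ModuleCat.{u} (DualAlgebra k C) where
  obj M := ModuleCat.of (DualAlgebra k C) M.carrier
  map {M N} f := ModuleCat.ofHom
    { toFun := linMap f
      map_add' := map_add _
      map_smul' := fun a m => by
        have h := LinearMap.congr_fun (linMap_comm f) m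
        simp only [LinearMap.comp_apply] at h
        have h2 : ∀ t : C ⊗[k] M.carrier,
            linMap f (TensorProduct.lid k M.carrier (LinearMap.rTensor M.carrier a.fn t)) =
            TensorProduct.lid k N.carrier (LinearMap.rTensor N.carrier a.fn
              (LinearMap.lTensor C (linMap f) t)) := by
          intro t
          induction t using TensorProduct.induction_on with
          | zero => simp
          | add x y hx hy => simp only [map_add, hx, hy]
          | tmul c x => simp
        rw [RingHom.id_apply, dual_smul_def, dual_smul_def, h, h2] }

/-! #### `C-Comod` is a `k`-linear abelian category -/

section Preadditive

variable {M N : LeftComodule k C}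

instance : Zero (M ⟶ N) := ⟨(⟨0, by simp⟩ : Hom M N)⟩
instance : Add (M ⟶ N) := ⟨fun f g => (⟨linMap f + linMap g, by
  rw [LinearMap.comp_add, linMap_comm, linMap_comm, LinearMap.lTensor_add,
    LinearMap.add_comp]⟩ : Hom M N)⟩
instance : Neg (M ⟶ N) := ⟨fun f => (⟨-linMap f, by
  rw [LinearMap.comp_neg, linMap_comm, LinearMap.lTensor_neg, LinearMap.neg_comp]⟩ : Hom M N)⟩
instance : SMul k (M ⟶ N) := ⟨fun a f => (⟨a • linMap f, by
  rw [LinearMap.comp_smul, linMap_comm, LinearMap.lTensor_smul, LinearMap.smul_comp]⟩ : Hom M N)⟩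

@[simp] theorem linMap_zero : linMap (0 : M ⟶ N) = 0 := rfl
@[simp] theorem linMap_add (f g : M ⟶ N) : linMap (f + g) = linMap f + linMap g := rfl
@[simp] theorem linMap_neg (f : M ⟶ N) : linMap (-f) = -linMap f := rfl
@[simp] theorem linMap_smul (a : k) (f : M ⟶ N) : linMap (a • f) = a • linMap f := rfl

instance : AddCommGroup (M ⟶ N) where
  add_assoc f g h := linMap_injective (add_assoc (linMap f) (linMap g) (linMap h))
  zero_add f := linMap_injective (zero_add (linMap f))
  add_zero f := linMap_injective (add_zero (linMap f))
  add_comm f g := linMap_injective (add_comm (linMap f) (linMap g))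
  neg_add_cancel f := linMap_injective (neg_add_cancel (linMap f))
  nsmul := nsmulRec
  zsmul := zsmulRec

instance : Module k (M ⟶ N) where
  one_smul f := linMap_injective (one_smul k (linMap f))
  mul_smul a b f := linMap_injective (mul_smul a b (linMap f))
  smul_zero a := linMap_injective (smul_zero a)
  smul_add a f g := linMap_injective (smul_add a (linMap f) (linMap g))
  add_smul a b f := linMap_injective (add_smul a b (linMap f))
  zero_smul f := linMap_injective (zero_smul k (linMap f))

end Preadditive

instance preadditive : Preadditive (LeftComodule k C) where
  add_comp _ _ _ f g h := linMap_injective (LinearMap.comp_add (linMap f) (linMap g) (linMap h))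
  comp_add _ _ _ f g h := linMap_injective (LinearMap.add_comp (linMap f) (linMap h) (linMap g))

instance linear : Linear k (LeftComodule k C) where
  homModule _ _ := inferInstance
  smul_comp _ _ _ a f g := linMap_injective (LinearMap.comp_smul (linMap g) a (linMap f))
  comp_smul _ _ _ f a g := linMap_injective (LinearMap.smul_comp a (linMap g) (linMap f))

theorem lTensor_injective {D V W : Type u} [AddCommGroup D] [Module k D] [AddCommGroup V] [Module k V] [AddCommGroup W]
    [Module k W] {i : V →ₗ[k] W} (hi : Function.Injective i) :
    Function.Injective (LinearMap.lTensor D i) :=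
  Module.Flat.lTensor_preserves_injective_linearMap i hi

theorem assoc_rTensor_lTensor {V W : Type u} [AddCommGroup V] [Module k V] [AddCommGroup W]
    [Module k W] (i : V →ₗ[k] W) (ν : V →ₗ[k] C ⊗[k] V) :
    (TensorProduct.assoc k C C W).toLinearMap ∘ₗ
      LinearMap.rTensor W Coalgebra.comul ∘ₗ LinearMap.lTensor C i ∘ₗ ν =
    LinearMap.lTensor C (LinearMap.lTensor C i) ∘ₗ
      ((TensorProduct.assoc k C C V).toLinearMap ∘ₗ
        LinearMap.rTensor V Coalgebra.comul ∘ₗ ν) := by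
  have e : (TensorProduct.assoc k C C W).toLinearMap ∘ₗ
        LinearMap.rTensor W Coalgebra.comul ∘ₗ LinearMap.lTensor C i =
      LinearMap.lTensor C (LinearMap.lTensor C i) ∘ₗ
      (TensorProduct.assoc k C C V).toLinearMap ∘ₗ LinearMap.rTensor V Coalgebra.comul := by
    ext c v
    simp only [TensorProduct.AlgebraTensorModule.curry_apply, LinearMap.restrictScalars_self,
      TensorProduct.curry_apply, LinearMap.comp_apply, LinearMap.rTensor_tmul,
      LinearMap.lTensor_tmul, LinearEquiv.coe_coe]
    generalize (Coalgebra.comul (R := k) c) = d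
    induction d using TensorProduct.induction_on with
    | zero => simp
    | add a b ha hb => simp only [map_add, TensorProduct.add_tmul, ha, hb]
    | tmul a b => simp
  exact congrArg (fun t => t ∘ₗ ν) e

theorem lid_rTensor_lTensor {V W : Type u} [AddCommGroup V] [Module k V] [AddCommGroup W]
    [Module k W] (i : V →ₗ[k] W) (ν : V →ₗ[k] C ⊗[k] V) :
    (TensorProduct.lid k W).toLinearMap ∘ₗ
      LinearMap.rTensor W Coalgebra.counit ∘ₗ LinearMap.lTensor C i ∘ₗ ν =
    i ∘ₗ ((TensorProduct.lid k V).toLinearMap ∘ₗ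
      LinearMap.rTensor V Coalgebra.counit ∘ₗ ν) := by
  have e : (TensorProduct.lid k W).toLinearMap ∘ₗ
      LinearMap.rTensor W (Coalgebra.counit (R := k) (A := C)) ∘ₗ LinearMap.lTensor C i =
      i ∘ₗ ((TensorProduct.lid k V).toLinearMap ∘ₗ
        LinearMap.rTensor V Coalgebra.counit) := by
    ext c v; simp
  exact congrArg (fun t => t ∘ₗ ν) e

/-- The comodule structure on a vector space that embeds into a comodule compatibly with a
given linear map `V → C ⊗ V`. -/
def ofInjective (M : LeftComodule k C) {V : Type u} [AddCommGroup V] [Module k V]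
    (i : V →ₗ[k] M.carrier) (hi : Function.Injective i) (ν : V →ₗ[k] C ⊗[k] V)
    (h : LinearMap.lTensor C i ∘ₗ ν = M.coact ∘ₗ i) : LeftComodule k C where
  carrier := V
  coact := ν
  coassoc := by
    rw [← LinearMap.cancel_left (lTensor_injective (D := C) (lTensor_injective (D := C) hi)),
      ← assoc_rTensor_lTensor, h]
    calc _ = ((TensorProduct.assoc k C C M.carrier).toLinearMap ∘ₗ
          LinearMap.rTensor M.carrier Coalgebra.comul ∘ₗ M.coact) ∘ₗ i := rfl
      _ = LinearMap.lTensor C (M.coact ∘ₗ i) ∘ₗ ν := by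
        rw [M.coassoc, LinearMap.comp_assoc, ← h, ← LinearMap.comp_assoc,
          ← LinearMap.lTensor_comp, h]
      _ = _ := by
        rw [← h, LinearMap.lTensor_comp, LinearMap.comp_assoc]
  counit_coact := by
    rw [← LinearMap.cancel_left hi, ← lid_rTensor_lTensor, h]
    exact congrArg (fun t => t ∘ₗ i) M.counit_coact

/-- The comodule structure on a quotient space of a comodule compatible with a
given linear map `V → C ⊗ V`. -/
def ofSurjective (M : LeftComodule k C) {V : Type u} [AddCommGroup V] [Module k V]
    (p : M.carrier →ₗ[k] V) (hp : Function.Surjective p) (ν : V →ₗ[k] C ⊗[k] V)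
    (h : ν ∘ₗ p = LinearMap.lTensor C p ∘ₗ M.coact) : LeftComodule k C where
  carrier := V
  coact := ν
  coassoc := by
    rw [← LinearMap.cancel_right hp]
    simp only [LinearMap.comp_assoc]
    rw [h, assoc_rTensor_lTensor, M.coassoc, ← LinearMap.comp_assoc, ← LinearMap.comp_assoc,
      ← LinearMap.lTensor_comp, ← LinearMap.lTensor_comp, h]
  counit_coact := by
    rw [← LinearMap.cancel_right hp]
    simp only [LinearMap.comp_assoc]
    rw [h, lid_rTensor_lTensor, M.counit_coact]
    rfl

/-- The subcomodule of `M` on a subspace `W` with `ν (W) ⊆ C ⊗ W`. -/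
noncomputable def sub (M : LeftComodule k C) (W : Submodule k M.carrier)
    (hW : ∀ w ∈ W, M.coact w ∈ LinearMap.range (LinearMap.lTensor C W.subtype)) :
    LeftComodule k C :=
  M.ofInjective W.subtype W.injective_subtype
    ((LinearEquiv.ofInjective _ (lTensor_injective (D := C) W.injective_subtype)).symm.toLinearMap
      ∘ₗ LinearMap.codRestrict _ (M.coact ∘ₗ W.subtype) (fun w => hW w.1 w.2)) (by
    ext w
    exact congrArg Subtype.val ((LinearEquiv.ofInjective _ (lTensor_injective (D := C)
      W.injective_subtype)).apply_symm_apply _))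

/-- The quotient comodule of `M` by a subspace `W` with `ν (W) ⊆ ker (C ⊗ M → C ⊗ M / W)`. -/
def quot (M : LeftComodule k C) (W : Submodule k M.carrier)
    (hW : ∀ w ∈ W, LinearMap.lTensor C W.mkQ (M.coact w) = 0) : LeftComodule k C :=
  M.ofSurjective W.mkQ W.mkQ_surjective (W.liftQ (LinearMap.lTensor C W.mkQ ∘ₗ M.coact) hW)
    (W.liftQ_mkQ _ _)

theorem coact_ker {M N : LeftComodule k C} (f : M ⟶ N) :
    ∀ w ∈ LinearMap.ker (linMap f), M.coact w ∈
      LinearMap.range (LinearMap.lTensor C (LinearMap.ker (linMap f)).subtype) := by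
  intro w hw
  have hex := Module.Flat.lTensor_exact C (LinearMap.exact_subtype_ker_map (linMap f))
  refine (hex _).1 ?_
  have h := LinearMap.congr_fun (linMap_comm f) w
  simp only [LinearMap.comp_apply] at h
  rw [← h, LinearMap.mem_ker.1 hw, map_zero]

theorem coact_range {M N : LeftComodule k C} (f : M ⟶ N) :
    ∀ w ∈ LinearMap.range (linMap f),
      LinearMap.lTensor C (LinearMap.range (linMap f)).mkQ (N.coact w) = 0 := by
  rintro _ ⟨x, rfl⟩
  have h := LinearMap.congr_fun (linMap_comm f) x
  simp only [LinearMap.comp_apply] at h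
  rw [h, ← LinearMap.comp_apply, ← LinearMap.lTensor_comp, LinearMap.range_mkQ_comp]
  simp

/-- The kernel of a morphism of comodules. -/
noncomputable def ker {M N : LeftComodule k C} (f : M ⟶ N) : LeftComodule k C :=
  M.sub _ (coact_ker f)

/-- The inclusion of the kernel. -/
noncomputable def kerι {M N : LeftComodule k C} (f : M ⟶ N) : ker f ⟶ M :=
  (⟨(LinearMap.ker (linMap f)).subtype, by
    refine LinearMap.ext fun w => ?_
    exact (congrArg Subtype.val ((LinearEquiv.ofInjective _ (lTensor_injective (D := C)
      (LinearMap.ker (linMap f)).injective_subtype)).apply_symm_apply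
        ⟨M.coact w.1, coact_ker f w.1 w.2⟩)).symm⟩ : Hom _ _)

/-- The cokernel of a morphism of comodules. -/
def coker {M N : LeftComodule k C} (f : M ⟶ N) : LeftComodule k C :=
  N.quot _ (coact_range f)

/-- The projection onto the cokernel. -/
def cokerπ {M N : LeftComodule k C} (f : M ⟶ N) : N ⟶ coker f :=
  (⟨(LinearMap.range (linMap f)).mkQ, (LinearMap.range (linMap f)).liftQ_mkQ _ _⟩ : Hom _ _)

theorem kerι_injective {M N : LeftComodule k C} (f : M ⟶ N) :
    Function.Injective (linMap (kerι f)) := (LinearMap.ker (linMap f)).injective_subtype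

theorem cokerπ_surjective {M N : LeftComodule k C} (f : M ⟶ N) :
    Function.Surjective (linMap (cokerπ f)) := (LinearMap.range (linMap f)).mkQ_surjective

theorem kerι_comp {M N : LeftComodule k C} (f : M ⟶ N) : kerι f ≫ f = 0 :=
  linMap_injective (LinearMap.ext fun w => w.2)

theorem comp_cokerπ {M N : LeftComodule k C} (f : M ⟶ N) : f ≫ cokerπ f = 0 :=
  linMap_injective (LinearMap.range_mkQ_comp (linMap f))

theorem exists_lift {L M N : LeftComodule k C} (i : M ⟶ N) (hi : Function.Injective (linMap i))
    (g : L ⟶ N) (hg : LinearMap.range (linMap g) ≤ LinearMap.range (linMap i)) :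
    ∃ l : L ⟶ M, l ≫ i = g := by
  let e := LinearEquiv.ofInjective (linMap i) hi
  let l : L.carrier →ₗ[k] M.carrier :=
    e.symm.toLinearMap ∘ₗ LinearMap.codRestrict _ (linMap g) (fun x => hg ⟨x, rfl⟩)
  have hl : linMap i ∘ₗ l = linMap g := by
    ext x
    exact congrArg Subtype.val (e.apply_symm_apply _)
  refine ⟨(⟨l, ?_⟩ : Hom L M), linMap_injective hl⟩
  rw [← LinearMap.cancel_left (lTensor_injective (D := C) hi), ← LinearMap.comp_assoc,
    ← linMap_comm, LinearMap.comp_assoc, hl, linMap_comm, ← LinearMap.comp_assoc,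
    ← LinearMap.lTensor_comp, hl]

theorem exists_desc {L M N : LeftComodule k C} (p : M ⟶ N) (hp : Function.Surjective (linMap p))
    (g : M ⟶ L) (hg : LinearMap.ker (linMap p) ≤ LinearMap.ker (linMap g)) :
    ∃ l : N ⟶ L, p ≫ l = g := by
  let e := (linMap p).quotKerEquivOfSurjective hp
  let l : N.carrier →ₗ[k] L.carrier :=
    (LinearMap.ker (linMap p)).liftQ (linMap g) hg ∘ₗ e.symm.toLinearMap
  have hl : l ∘ₗ linMap p = linMap g := by
    ext x
    have : e.symm (linMap p x) = Submodule.Quotient.mk x := by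
      rw [LinearEquiv.symm_apply_eq]; rfl
    change (LinearMap.ker (linMap p)).liftQ (linMap g) hg (e.symm (linMap p x)) = _
    rw [this]; rfl
  refine ⟨(⟨l, ?_⟩ : Hom N L), linMap_injective hl⟩
  rw [← LinearMap.cancel_right hp, LinearMap.comp_assoc, hl, linMap_comm, LinearMap.comp_assoc,
    linMap_comm, ← LinearMap.comp_assoc, ← LinearMap.lTensor_comp, hl]

theorem mono_of_injective {M N : LeftComodule k C} (f : M ⟶ N)
    (hf : Function.Injective (linMap f)) : Mono f :=
  ⟨fun _ _ e => linMap_injective ((LinearMap.cancel_left hf).1 (congrArg linMap e))⟩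

theorem epi_of_surjective {M N : LeftComodule k C} (f : M ⟶ N)
    (hf : Function.Surjective (linMap f)) : Epi f :=
  ⟨fun _ _ e => linMap_injective ((LinearMap.cancel_right hf).1 (congrArg linMap e))⟩

theorem injective_of_mono {M N : LeftComodule k C} (f : M ⟶ N) [Mono f] :
    Function.Injective (linMap f) := by
  have h : kerι f = 0 := by
    rw [← cancel_mono f, kerι_comp, Limits.zero_comp]
  rw [← LinearMap.ker_eq_bot, Submodule.eq_bot_iff]
  intro x hx
  exact LinearMap.congr_fun (congrArg linMap h) (⟨x, hx⟩ : LinearMap.ker (linMap f))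

theorem surjective_of_epi {M N : LeftComodule k C} (f : M ⟶ N) [Epi f] :
    Function.Surjective (linMap f) := by
  have h : cokerπ f = 0 := by
    rw [← cancel_epi f, comp_cokerπ, Limits.comp_zero]
  rw [← LinearMap.range_eq_top, Submodule.eq_top_iff']
  intro x
  rw [← Submodule.Quotient.mk_eq_zero]
  exact LinearMap.congr_fun (congrArg linMap h) x

/-- An injective morphism whose range is the kernel of `g` is a kernel of `g`. -/
noncomputable def isLimitOfInjective {L M N : LeftComodule k C} (i : L ⟶ M) (g : M ⟶ N)
    (w : i ≫ g = 0) (hi : Function.Injective (linMap i))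
    (hr : LinearMap.ker (linMap g) ≤ LinearMap.range (linMap i)) :
    Limits.IsLimit (Limits.KernelFork.ofι i w) :=
  haveI := mono_of_injective i hi
  Limits.KernelFork.IsLimit.ofι' i w fun {A} s hs =>
    have h : LinearMap.range (linMap s) ≤ LinearMap.range (linMap i) := by
      refine le_trans ?_ hr
      rw [LinearMap.range_le_ker_iff]
      exact congrArg linMap hs
    ⟨(exists_lift i hi s h).choose, (exists_lift i hi s h).choose_spec⟩

/-- A surjective morphism whose kernel is the range of `f` is a cokernel of `f`. -/
noncomputable def isColimitOfSurjective {L M N : LeftComodule k C} (f : L ⟶ M) (p : M ⟶ N)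
    (w : f ≫ p = 0) (hp : Function.Surjective (linMap p))
    (hr : LinearMap.ker (linMap p) ≤ LinearMap.range (linMap f)) :
    Limits.IsColimit (Limits.CokernelCofork.ofπ p w) :=
  haveI := epi_of_surjective p hp
  Limits.CokernelCofork.IsColimit.ofπ' p w fun {A} s hs =>
    have h : LinearMap.ker (linMap p) ≤ LinearMap.ker (linMap s) := by
      refine le_trans hr ?_
      rw [LinearMap.range_le_ker_iff]
      exact congrArg linMap hs
    ⟨(exists_desc p hp s h).choose, (exists_desc p hp s h).choose_spec⟩

/-- The coaction on a direct sum. -/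
def prodCoact (M N : LeftComodule k C) :
    M.carrier × N.carrier →ₗ[k] C ⊗[k] (M.carrier × N.carrier) :=
  (LinearMap.lTensor C (LinearMap.inl k M.carrier N.carrier) ∘ₗ M.coact).coprod
    (LinearMap.lTensor C (LinearMap.inr k M.carrier N.carrier) ∘ₗ N.coact)

theorem prodCoact_inl (M N : LeftComodule k C) :
    prodCoact M N ∘ₗ LinearMap.inl k M.carrier N.carrier =
      LinearMap.lTensor C (LinearMap.inl k M.carrier N.carrier) ∘ₗ M.coact :=
  LinearMap.coprod_inl _ _

theorem prodCoact_inr (M N : LeftComodule k C) :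
    prodCoact M N ∘ₗ LinearMap.inr k M.carrier N.carrier =
      LinearMap.lTensor C (LinearMap.inr k M.carrier N.carrier) ∘ₗ N.coact :=
  LinearMap.coprod_inr _ _

theorem lTensor_fst_prodCoact (M N : LeftComodule k C) :
    LinearMap.lTensor C (LinearMap.fst k M.carrier N.carrier) ∘ₗ prodCoact M N =
      M.coact ∘ₗ LinearMap.fst k M.carrier N.carrier := by
  apply LinearMap.prod_ext
  · rw [LinearMap.comp_assoc, prodCoact_inl, ← LinearMap.comp_assoc, ← LinearMap.lTensor_comp,
      LinearMap.comp_assoc, LinearMap.fst_comp_inl]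
    simp
  · rw [LinearMap.comp_assoc, prodCoact_inr, ← LinearMap.comp_assoc, ← LinearMap.lTensor_comp,
      LinearMap.comp_assoc, LinearMap.fst_comp_inr]
    simp

theorem lTensor_snd_prodCoact (M N : LeftComodule k C) :
    LinearMap.lTensor C (LinearMap.snd k M.carrier N.carrier) ∘ₗ prodCoact M N =
      N.coact ∘ₗ LinearMap.snd k M.carrier N.carrier := by
  apply LinearMap.prod_ext
  · rw [LinearMap.comp_assoc, prodCoact_inl, ← LinearMap.comp_assoc, ← LinearMap.lTensor_comp,
      LinearMap.comp_assoc, LinearMap.snd_comp_inl]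
    simp
  · rw [LinearMap.comp_assoc, prodCoact_inr, ← LinearMap.comp_assoc, ← LinearMap.lTensor_comp,
      LinearMap.comp_assoc, LinearMap.snd_comp_inr]
    simp

/-- The direct sum of two comodules. -/
def prod (M N : LeftComodule k C) : LeftComodule k C where
  carrier := M.carrier × N.carrier
  coact := prodCoact M N
  coassoc := by
    apply LinearMap.prod_ext
    · simp only [LinearMap.comp_assoc, prodCoact_inl]
      rw [assoc_rTensor_lTensor, M.coassoc, ← LinearMap.comp_assoc, ← LinearMap.comp_assoc,
        ← LinearMap.lTensor_comp, ← LinearMap.lTensor_comp, prodCoact_inl]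
    · simp only [LinearMap.comp_assoc, prodCoact_inr]
      rw [assoc_rTensor_lTensor, N.coassoc, ← LinearMap.comp_assoc, ← LinearMap.comp_assoc,
        ← LinearMap.lTensor_comp, ← LinearMap.lTensor_comp, prodCoact_inr]
  counit_coact := by
    apply LinearMap.prod_ext
    · simp only [LinearMap.comp_assoc, prodCoact_inl]
      rw [lid_rTensor_lTensor, M.counit_coact]; rfl
    · simp only [LinearMap.comp_assoc, prodCoact_inr]
      rw [lid_rTensor_lTensor, N.counit_coact]; rfl

/-- The direct sum as a biproduct. -/
def prodBicone (M N : LeftComodule k C) : Limits.BinaryBicone M N where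
  pt := prod M N
  inl := (⟨LinearMap.inl k M.carrier N.carrier, prodCoact_inl M N⟩ : Hom M (prod M N))
  inr := (⟨LinearMap.inr k M.carrier N.carrier, prodCoact_inr M N⟩ : Hom N (prod M N))
  fst := (⟨LinearMap.fst k M.carrier N.carrier, (lTensor_fst_prodCoact M N).symm⟩ :
    Hom (prod M N) M)
  snd := (⟨LinearMap.snd k M.carrier N.carrier, (lTensor_snd_prodCoact M N).symm⟩ :
    Hom (prod M N) N)
  inl_fst := linMap_injective (LinearMap.fst_comp_inl k M.carrier N.carrier)
  inl_snd := linMap_injective (LinearMap.snd_comp_inl k M.carrier N.carrier)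
  inr_fst := linMap_injective (LinearMap.fst_comp_inr k M.carrier N.carrier)
  inr_snd := linMap_injective (LinearMap.snd_comp_inr k M.carrier N.carrier)

/-- The zero comodule. -/
def zeroObj : LeftComodule k C where
  carrier := PUnit
  coact := 0
  coassoc := by simp
  counit_coact := Subsingleton.elim _ _

instance hasZeroObject : Limits.HasZeroObject (LeftComodule k C) :=
  ⟨zeroObj, (Limits.IsZero.iff_id_eq_zero _).2
    (linMap_injective (LinearMap.ext fun _ => Subsingleton.elim (α := PUnit) _ _))⟩

instance hasBinaryBiproducts : Limits.HasBinaryBiproducts (LeftComodule k C) where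
  has_binary_biproduct M N := Limits.hasBinaryBiproduct_of_total (prodBicone M N)
    (linMap_injective (LinearMap.ext fun (x : M.carrier × N.carrier) =>
      (Prod.ext (add_zero x.1) (zero_add x.2) : ((x.1, 0) + (0, x.2) : M.carrier × N.carrier) = x)))

instance hasFiniteProducts : Limits.HasFiniteProducts (LeftComodule k C) :=
  hasFiniteProducts_of_has_binary_and_terminal

instance hasKernels : Limits.HasKernels (LeftComodule k C) where
  has_limit f := ⟨⟨⟨_, isLimitOfInjective (kerι f) f (kerι_comp f) (kerι_injective f)
    (le_of_eq (Submodule.range_subtype _).symm)⟩⟩⟩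

instance hasCokernels : Limits.HasCokernels (LeftComodule k C) where
  has_colimit f := ⟨⟨⟨_, isColimitOfSurjective f (cokerπ f) (comp_cokerπ f) (cokerπ_surjective f)
    (le_of_eq (Submodule.ker_mkQ _))⟩⟩⟩

noncomputable instance abelian : Abelian (LeftComodule k C) where
  normalMonoOfMono f _ := ⟨⟨coker f, cokerπ f, comp_cokerπ f,
    isLimitOfInjective f (cokerπ f) (comp_cokerπ f) (injective_of_mono f)
      (le_of_eq (Submodule.ker_mkQ _))⟩⟩
  normalEpiOfEpi f _ := ⟨⟨ker f, kerι f, kerι_comp f,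
    isColimitOfSurjective (kerι f) f (kerι_comp f) (surjective_of_epi f)
      (le_of_eq (Submodule.range_subtype _).symm)⟩⟩

end LeftComodule

/-! ### Left contramodules -/

/-- A left contramodule over the coalgebra `C`. -/
structure LeftContramodule (k C : Type u) [Field k] [AddCommGroup C] [Module k C]
    [Coalgebra k C] where
  /-- the underlying vector space -/
  carrier : Type u
  [isAddCommGroup : AddCommGroup carrier]
  [isModule : Module k carrier]
  /-- the contraaction `π : Hom (C, P) → P` -/
  contra : (C →ₗ[k] carrier) →ₗ[k] carrier
  /-- Contraassociativity; `g : C ⊗ C → P` corresponds to the map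
  `C → Hom (C, P)`, `v ↦ (u ↦ g (u ⊗ v))`. -/
  contraassoc : ∀ g : C ⊗[k] C →ₗ[k] carrier,
    contra (contra ∘ₗ (TensorProduct.curry g).flip) = contra (g ∘ₗ Coalgebra.comul)
  contraunit : ∀ p : carrier, contra ((Coalgebra.counit (R := k) (A := C)).smulRight p) = p

namespace LeftContramodule

attribute [instance] isAddCommGroup isModule

variable {k C : Type u} [Field k] [AddCommGroup C] [Module k C] [Coalgebra k C]

/-- Morphisms of left contramodules: linear maps compatible with the contraactions. -/
@[ext]
structure Hom (P Q : LeftContramodule k C) where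
  /-- the underlying linear map -/
  lin : P.carrier →ₗ[k] Q.carrier
  comm : ∀ x : C →ₗ[k] P.carrier, lin (P.contra x) = Q.contra (lin ∘ₗ x)

/-- The category `C-Contra` of left `C`-contramodules. -/
instance category : Category (LeftContramodule k C) where
  Hom P Q := Hom P Q
  id P := ⟨LinearMap.id, fun _ => rfl⟩
  comp f g := ⟨g.lin ∘ₗ f.lin, fun x => by
    rw [LinearMap.comp_apply, f.comm, g.comm, LinearMap.comp_assoc]⟩

/-- The action of the dual algebra on a left contramodule: the composition
`C* ⊗ P → Hom (C, P) → P`. -/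
instance dualSMul (P : LeftContramodule k C) : SMul (DualAlgebra k C) P.carrier where
  smul f p := P.contra (f.fn.smulRight p)

theorem dual_smul_def (P : LeftContramodule k C) (f : DualAlgebra k C) (p : P.carrier) :
    f • p = P.contra (f.fn.smulRight p) := rfl

theorem dual_mul_smul (P : LeftContramodule k C) (f g : DualAlgebra k C) (p : P.carrier) :
    (f * g) • p = f • g • p := by
  have h := P.contraassoc
    ((LinearMap.mul' k k ∘ₗ TensorProduct.map g.fn f.fn).smulRight p)
  have h1 : P.contra ∘ₗ (TensorProduct.curry
      ((LinearMap.mul' k k ∘ₗ TensorProduct.map g.fn f.fn).smulRight p)).flip =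
      f.fn.smulRight (P.contra (g.fn.smulRight p)) := by
    ext c
    rw [LinearMap.smulRight_apply, LinearMap.comp_apply, ← map_smul]
    congr 1
    ext d
    simp [mul_smul, smul_comm (g.fn d)]
  rw [h1] at h
  exact h.symm

/-- The left `C*`-module structure on a left `C`-contramodule. -/
instance dualModule (P : LeftContramodule k C) : Module (DualAlgebra k C) P.carrier where
  one_smul p := by
    rw [dual_smul_def, DualAlgebra.fn_one]
    exact P.contraunit p
  mul_smul := dual_mul_smul P
  smul_zero f := by rw [dual_smul_def, ← map_zero P.contra]; congr 1; ext; simp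
  smul_add f x y := by
    simp only [dual_smul_def]; rw [← map_add P.contra]; congr 1; ext; simp
  add_smul f g x := by
    simp only [dual_smul_def]; rw [← map_add P.contra]; congr 1; ext
    simp [DualAlgebra.fn_add, add_smul]
  zero_smul x := by
    rw [dual_smul_def, ← map_zero P.contra]; congr 1; ext; simp [DualAlgebra.fn_zero]

variable (k C) in
/-- The contramodule forgetful functor `Θ : C-Contra ⥤ C*-Mod`. -/
noncomputable def theta : LeftContramodule k C ⥤ ModuleCat.{u} (DualAlgebra k C) where
  obj P := ModuleCat.of (DualAlgebra k C) P.carrier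
  map {P Q} f := ModuleCat.ofHom
    { toFun := Hom.lin f
      map_add' := map_add _
      map_smul' := fun a p => by
        rw [RingHom.id_apply, dual_smul_def, dual_smul_def]
        refine (Hom.comm f _).trans ?_
        congr 1
        ext c
        simp }

end LeftContramodule

/-! ### Conilpotent and finitely cogenerated coalgebras -/

section Coaugmented

variable {k C : Type u} [Field k] [AddCommGroup C] [Module k C] [Coalgebra k C]

/-- The cokernel `D = C / γ(k)` of a coaugmentation `γ : k → C`. -/
abbrev CoaugQuotient (γ : k →ₗc[k] C) : Type u := C ⧸ LinearMap.range γ.toLinearMap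

/-- The comultiplication `D → D ⊗ D` of the noncounital coalgebra `D = C / γ(k)`, induced by that
of `C`. -/
def reducedComul (γ : k →ₗc[k] C) :
    CoaugQuotient γ →ₗ[k] CoaugQuotient γ ⊗[k] CoaugQuotient γ :=
  (LinearMap.range γ.toLinearMap).liftQ
    (TensorProduct.map (LinearMap.range γ.toLinearMap).mkQ (LinearMap.range γ.toLinearMap).mkQ ∘ₗ
      Coalgebra.comul) (by
    rintro _ ⟨a, rfl⟩
    have h := LinearMap.congr_fun γ.map_comp_comul a
    rw [LinearMap.mem_ker, LinearMap.comp_apply]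
    simp only [LinearMap.comp_apply] at h
    rw [← h, ← LinearMap.comp_apply, ← TensorProduct.map_comp, LinearMap.range_mkQ_comp]
    simp)

/-- The iterated comultiplication `μ⁽ⁿ⁾ : D → D^{⊗ n+1}` of `D = C / γ(k)`. -/
noncomputable def iteratedComul (γ : k →ₗc[k] C) :
    (n : ℕ) → CoaugQuotient γ →ₗ[k] TensorPower k (n + 1) (CoaugQuotient γ)
  | 0 => (PiTensorProduct.subsingletonEquiv (R := k)
      (s := fun _ => CoaugQuotient γ) (0 : Fin 1)).symm.toLinearMap
  | n + 1 => TensorPower.mulEquiv.toLinearMap ∘ₗ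
      TensorProduct.map (iteratedComul γ n)
        (PiTensorProduct.subsingletonEquiv (R := k)
          (s := fun _ => CoaugQuotient γ) (0 : Fin 1)).symm.toLinearMap ∘ₗ reducedComul γ

/-- A coaugmented coalgebra `(C, γ)` is conilpotent if every element of `D = C / γ(k)` is
annihilated by some iterated comultiplication map. -/
def IsConilpotent (γ : k →ₗc[k] C) : Prop :=
  ∀ d : CoaugQuotient γ, ∃ n : ℕ, 1 ≤ n ∧ iteratedComul γ n d = 0

/-- The one-dimensional left comodule `k` defined by a coaugmentation, with the coaction
`a ↦ γ(a) ⊗ 1`. -/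
def LeftComodule.trivial (γ : k →ₗc[k] C) : LeftComodule k C where
  carrier := k
  coact := (TensorProduct.rid k C).symm.toLinearMap ∘ₗ γ.toLinearMap
  coassoc := by
    ext
    have h := LinearMap.congr_fun γ.map_comp_comul 1
    simp only [LinearMap.comp_apply] at h
    have h1 : Coalgebra.comul (R := k) (γ 1) = γ 1 ⊗ₜ[k] γ 1 := by
      refine Eq.trans h.symm ?_
      simp
    simp [h1]
  counit_coact := by
    ext
    simp

/-- A conilpotent coalgebra is finitely cogenerated if the vector space `Ext¹_C(k, k)`, computed
in the abelian category of left `C`-comodules, is finite-dimensional. -/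
def IsFinitelyCogenerated (γ : k →ₗc[k] C) : Prop :=
  haveI : HasExt.{u + 1} (LeftComodule k C) := HasExt.standard _
  Module.Finite k
    (Abelian.Ext.{u + 1} (LeftComodule.trivial γ) (LeftComodule.trivial γ) 1)

end Coaugmented

/-! ### Torsion modules and contramodules over an ideal -/

/-- An `R`-module `M` is `I`-torsion if for all `s ∈ I` and `x ∈ M` there is `n ≥ 1` with
`sⁿ x = 0`. -/
def IsITorsion {R : Type u} [CommRing R] (I : Ideal R) : ObjectProperty (ModuleCat.{u} R) :=
  fun M => ∀ s ∈ I, ∀ x : M, ∃ n : ℕ, 1 ≤ n ∧ s ^ n • x = 0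

/-- An `R`-module `P` is an `I`-contramodule if `Hom_R(R[s⁻¹], P) = 0 = Ext¹_R(R[s⁻¹], P)` for all
`s ∈ I`. -/
def IsIContramodule {R : Type u} [CommRing R] (I : Ideal R) : ObjectProperty (ModuleCat.{u} R) :=
  fun P => ∀ s ∈ I,
    Subsingleton (ModuleCat.of R (Localization.Away s) ⟶ P) ∧
    Subsingleton (Abelian.Ext.{u} (ModuleCat.of R (Localization.Away s)) P 1)

/-! ### Telescope operators -/

section Telescope

variable {R : Type*} [CommRing R] {M : Type*} [AddCommGroup M] [Module R M]

/-! Write R = C* and let I be its augmentation ideal, the functionals vanishing at γ(1). R acts on C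
by r · c = r(c₍₁₎)c₍₂₎ (`act`), and the product h * r is the functional h ∘ act r, so multiplication
in R is read off from operators on C. Conilpotency makes every element of C vanish under a power of
I, because functionals in I^(n+1) factor through μ⁽ⁿ⁾ (`exists_mem_perp_pow`). Finite cogeneration
bounds the primitive elements of C/γ(k): they form Hom(k, C/k), which embeds into Ext¹(k, k).
Extending coordinates on them gives s₁, …, sₘ in I whose common kernel on C is γ(k)
(`exists_detecting`). Over a field, a functional vanishing on a common kernel of operators is a sum
of functionals composed with these operators. Hence finitely generated ideals are closed, and I =
(s₁, …, sₘ).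

The contramodule condition is made elementary by resolving R[s⁻¹] by sX - 1 on R[X]: it says that
(qₙ) ↦ (qₙ - s qₙ₊₁) is bijective on sequences in P (`telescope_bijective_iff`). Then 1 - sA is
invertible for every endomorphism A, also on modules of functions X → P, where A may be
precomposition with any self-map of the set X. This yields a Nakayama lemma for arbitrary submodules
of P (`eq_zero_of_mem_span_smul_span`). For P = R, surjectivity sums power series in s, and a
Cohen-type argument shows that R is Noetherian.

For comodules, an element m killed by Iⁿ has a coaction because the annihilator of Iⁿ in C is
finite-dimensional and Iⁿ is closed.

For contramodules, everything rests on a universal property: a k-linear map α : V → P into an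
I-contramodule extends uniquely to an R-linear map h : Hom(C, V) → P. A splitting c = ε(c)γ(1) + ∑
ρᵢ(sᵢ · c) writes each x as a constant plus ∑ sᵢ(x ∘ ρᵢ), and Nakayama gives uniqueness
(`eq_of_eq_on_constMap`). For existence (`exists_extension`), the recursion h(x) = α(x(γ1)) + ∑ sᵢ
h(x ∘ ρᵢ) is solved among arbitrary functions. Nakayama then forces additivity and, through the
finitely many syzygies of the sᵢ, R-linearity. The contraaction on P is the extension of the
identity, and contraassociativity is an instance of uniqueness. -/

/-- The operator `(qₙ) ↦ (qₙ - s qₙ₊₁)` on sequences in a module. -/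
def telescope (s : R) (M : Type*) [AddCommGroup M] [Module R M] : (ℕ → M) →ₗ[R] (ℕ → M) where
  toFun q n := q n - s • q (n + 1)
  map_add' p q := by ext n; simp only [Pi.add_apply, smul_add]; abel
  map_smul' a q := by ext n; simp only [Pi.smul_apply, RingHom.id_apply, smul_sub, smul_comm s a]

theorem telescope_apply (s : R) (q : ℕ → M) (n : ℕ) :
    telescope s M q n = q n - s • q (n + 1) := rfl

theorem eq_of_telescope_eq_zero {s : R} (h : Function.Injective (telescope s M)) {q : ℕ → M}
    (hq : ∀ n, q n = s • q (n + 1)) (n : ℕ) : q n = 0 := by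
  have : q = 0 := h (by
    rw [map_zero]
    ext n
    rw [telescope_apply, ← hq, sub_self]; rfl)
  rw [this]; rfl

/-- The formal inverse is ∑ sⁿAⁿ; the telescope equation for the sequence Aⁿa makes sense of this
sum without any topology. -/
theorem one_sub_smul_bijective {s : R} (h : Function.Bijective (telescope s M))
    (A : Module.End R M) : Function.Bijective (1 - s • A : Module.End R M) := by
  constructor
  · rw [injective_iff_map_eq_zero]
    intro x hx
    have hx' : x = s • A x := by simpa [sub_eq_zero] using hx
    refine eq_of_telescope_eq_zero h.1 (q := fun n => (A ^ n) x) (fun n => ?_) 0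
    rw [pow_succ, Module.End.mul_apply, ← map_smul, ← hx']
  · intro a
    obtain ⟨q, hq⟩ := h.2 (fun n => (A ^ n) a)
    have hq' (n : ℕ) : q n - s • q (n + 1) = (A ^ n) a := congrFun hq n
    -- The sequence A qₙ - qₙ₊₁ solves the homogeneous telescope equation, so q₁ = A q₀ and the
    -- equation at n = 0 becomes (1 - sA) q₀ = a.
    have hA : ∀ n, A (q n) - q (n + 1) = 0 := by
      refine eq_of_telescope_eq_zero h.1 (fun n => ?_)
      have h1 : A (q n) - s • A (q (n + 1)) = q (n + 1) - s • q (n + 2) := by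
        rw [hq' (n + 1), ← map_smul, ← map_sub, hq' n, pow_succ', Module.End.mul_apply]
      rw [smul_sub, sub_eq_sub_iff_add_eq_add]
      rw [sub_eq_sub_iff_add_eq_add] at h1
      rw [h1, add_comm]
    refine ⟨q 0, ?_⟩
    rw [LinearMap.sub_apply, LinearMap.smul_apply, sub_eq_zero.1 (hA 0)]
    exact hq' 0

theorem one_sub_sum_smul_bijective {ι : Type*} (t : Finset ι) {s : ι → R}
    (h : ∀ i, Function.Bijective (telescope (s i) M)) (A : ι → Module.End R M) :
    Function.Bijective (1 - ∑ i ∈ t, s i • A i : Module.End R M) := by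
  classical
  induction t using Finset.induction_on with
  | empty =>
    rw [Finset.sum_empty, sub_zero]
    exact Function.bijective_id
  | insert a t ha ih =>
    let U := LinearEquiv.ofBijective (1 - ∑ i ∈ t, s i • A i : Module.End R M) ih
    -- Factor out the operator U already inverted; U⁻¹A is again R-linear, so the case of one
    -- element applies to it.
    have e : (1 - ∑ i ∈ insert a t, s i • A i : Module.End R M) =
        U.toLinearMap ∘ₗ (1 - s a • (U.symm.toLinearMap ∘ₗ A a) : Module.End R M) := by
      rw [Finset.sum_insert ha]
      ext x
      have hU (y : M) : U y = (1 - ∑ i ∈ t, s i • A i : Module.End R M) y := rfl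
      rw [LinearMap.comp_apply, LinearEquiv.coe_coe, LinearMap.sub_apply (1 : Module.End R M),
        LinearMap.sub_apply (1 : Module.End R M), map_sub U, LinearMap.smul_apply, map_smul,
        LinearMap.comp_apply, LinearEquiv.coe_coe, LinearEquiv.apply_symm_apply,
        Module.End.one_apply, hU]
      simp only [LinearMap.sub_apply, LinearMap.smul_apply, LinearMap.add_apply,
        Module.End.one_apply]
      abel
    rw [e]
    exact U.bijective.comp (one_sub_smul_bijective (h a) _)

theorem telescope_pi_bijective {s : R} (h : Function.Bijective (telescope s M)) (X : Type*) :
    Function.Bijective (telescope s (X → M)) := by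
  constructor
  · rw [injective_iff_map_eq_zero]
    intro q hq
    ext n x
    refine eq_of_telescope_eq_zero h.1 (q := fun n => q n x) (fun n => ?_) n
    exact sub_eq_zero.1 (congrFun (congrFun hq n) x)
  · intro a
    choose q hq using fun x => h.2 (fun n => a n x)
    exact ⟨fun n x => q x n, by ext n x; exact congrFun (hq x) n⟩

theorem exists_sum_of_mem_span_smul {ι : Type*} [Fintype ι] {s : ι → R} {N : Submodule R M} {x : M}
    (hx : x ∈ Ideal.span (Set.range s) • N) : ∃ f : ι → N, x = ∑ i, s i • (f i : M) := by
  induction hx using Submodule.smul_induction_on' with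
  | smul r hr n hn =>
    obtain ⟨c, rfl⟩ := Ideal.mem_span_range_iff_exists_fun.1 hr
    refine ⟨fun i => c i • ⟨n, hn⟩, ?_⟩
    simp [Finset.sum_smul, smul_smul, mul_comm]
  | add x _ y _ h1 h2 =>
    obtain ⟨f, rfl⟩ := h1
    obtain ⟨f', rfl⟩ := h2
    exact ⟨f + f', by simp [Finset.sum_add_distrib]⟩

/-- A Nakayama lemma: no restriction on the submodule `N` is needed. -/
theorem eq_bot_of_le_span_smul {ι : Type*} [Fintype ι] {s : ι → R}
    (h : ∀ i, Function.Bijective (telescope (s i) M)) {N : Submodule R M}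
    (hN : N ≤ Ideal.span (Set.range s) • N) : N = ⊥ := by
  choose D hD using fun x : N => exists_sum_of_mem_span_smul (hN x.2)
  -- Choosing coefficients gives mere functions D(·, i) : N → N. The inclusion N → M, as an element
  -- of the module of all functions, is fixed by ∑ sᵢ(precomposition with D(·, i)), hence is zero.
  have hb := one_sub_sum_smul_bijective Finset.univ (fun i => telescope_pi_bijective (h i) N)
    (fun i => LinearMap.funLeft R M (fun x => D x i))
  have h0 : (fun x : N => (x : M)) = 0 := hb.1 (by
    rw [map_zero, LinearMap.sub_apply, sub_eq_zero]
    ext x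
    simpa [LinearMap.funLeft_apply] using hD x)
  rw [Submodule.eq_bot_iff]
  exact fun x hx => congrFun h0 ⟨x, hx⟩

/-- The form in which Nakayama is applied: β measures the failure of some identity, and one shows
that each failure is an I-combination of failures. -/
theorem eq_zero_of_mem_span_smul_span {ι : Type*} [Fintype ι] {s : ι → R}
    (h : ∀ i, Function.Bijective (telescope (s i) M)) {X : Type*} {β : X → M}
    (hβ : ∀ x, β x ∈ Ideal.span (Set.range s) • Submodule.span R (Set.range β)) (x : X) :
    β x = 0 := by
  have hN : Submodule.span R (Set.range β) = ⊥ := eq_bot_of_le_span_smul h (by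
    rw [Submodule.span_le]
    rintro _ ⟨x, rfl⟩
    exact hβ x)
  exact (Submodule.mem_bot R).1 (hN ▸ Submodule.subset_span ⟨x, rfl⟩)

end Telescope

/-! ### A Noetherianity criterion -/

section Noetherian

variable {R : Type*} [CommRing R]

/-- As for power series rings: lift generators of (p + (f))/(f) to g_y in p. Since f ∉ p, any x in p
is a combination of the g_y plus f times an element of p; iterate and sum the resulting power series
in f. -/
theorem fg_of_prime_of_notMem {f : R} (hsurj : Function.Surjective (telescope f R))
    (hsep : ∀ x : R, (∀ n, f ^ n ∣ x) → x = 0) {p : Ideal R} [p.IsPrime] (hf : f ∉ p)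
    (h : (p ⊔ Ideal.span {f}).FG) : p.FG := by
  classical
  obtain ⟨S, hS⟩ := h
  have hSp (y : S) : ∃ g ∈ p, ∃ c, g + c * f = y := by
    have : (y : R) ∈ p ⊔ Ideal.span {f} := hS ▸ Submodule.subset_span y.2
    obtain ⟨g, hg, z, hz, e⟩ := Submodule.mem_sup.1 this
    obtain ⟨c, rfl⟩ := Ideal.mem_span_singleton'.1 hz
    exact ⟨g, hg, c, e⟩
  choose g hgp c hgc using hSp
  have hstep (x : p) : ∃ (a : S → R) (x' : p), (x : R) = ∑ y, a y * g y + f * x' := by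
    have hx : (x : R) ∈ Ideal.span (Set.range (Subtype.val : S → R)) := by
      rw [Subtype.range_coe]
      exact hS.symm ▸ (le_sup_left (a := p) (b := Ideal.span {f})) x.2
    obtain ⟨a, ha⟩ := Ideal.mem_span_range_iff_exists_fun.1 hx
    have e : (x : R) = ∑ y, a y * g y + f * ∑ y, a y * c y := by
      rw [← ha, Finset.mul_sum, ← Finset.sum_add_distrib]
      refine Finset.sum_congr rfl fun y _ => ?_
      rw [← hgc]; ring
    refine ⟨a, ⟨∑ y, a y * c y, ?_⟩, e⟩
    have : f * ∑ y, a y * c y ∈ p := by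
      rw [← sub_eq_iff_eq_add'.2 e]
      exact p.sub_mem x.2 (p.sum_mem fun y _ => p.mul_mem_left _ (hgp y))
    exact ((Ideal.IsPrime.mem_or_mem inferInstance this).resolve_left hf)
  choose a D hD using hstep
  refine ⟨Finset.univ.image g, le_antisymm ?_ fun x hx => ?_⟩
  · rw [Submodule.span_le]
    intro z hz
    obtain ⟨y, -, rfl⟩ := Finset.mem_image.1 hz
    exact hgp y
  -- The b y n are the tails ∑ fⁱ a(D^[n + i] x) y of the coefficient series, supplied by
  -- surjectivity of the telescope; separatedness then identifies x with ∑ b y 0 * g y.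
  · choose b hb using fun y => hsurj (fun n => a (D^[n] ⟨x, hx⟩) y)
    have hb' (y : S) (n : ℕ) : b y n - f * b y (n + 1) = a (D^[n] ⟨x, hx⟩) y := congrFun (hb y) n
    have hdiv (n : ℕ) : ∀ m, f ^ n ∣ (D^[m] ⟨x, hx⟩ : R) - ∑ y, b y m * g y := by
      induction n with
      | zero => simp
      | succ n ih =>
        intro m
        have e : (D^[m] ⟨x, hx⟩ : R) - ∑ y, b y m * g y =
            f * ((D^[m + 1] ⟨x, hx⟩ : R) - ∑ y, b y (m + 1) * g y) := by
          rw [Function.iterate_succ_apply', hD (D^[m] ⟨x, hx⟩)]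
          have : ∑ y, b y m * g y =
              ∑ y, a (D^[m] ⟨x, hx⟩) y * g y + f * ∑ y, b y (m + 1) * g y := by
            rw [Finset.mul_sum, ← Finset.sum_add_distrib]
            refine Finset.sum_congr rfl fun y _ => ?_
            rw [← hb']; ring
          rw [this]; ring
        rw [e, pow_succ']
        exact mul_dvd_mul_left f (ih (m + 1))
    have h0 := hsep _ fun n => hdiv n 0
    rw [sub_eq_zero] at h0
    change x = _ at h0
    rw [h0]
    exact Submodule.sum_mem _ fun y _ => Ideal.mul_mem_left _ _ (Submodule.subset_span (by simp))

/-- Cohen's theorem in R/J₀, lifted back along the finitely generated kernel J₀. -/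
theorem fg_of_prime_fg {J₀ : Ideal R} (h₀ : J₀.FG)
    (h : ∀ p : Ideal R, p.IsPrime → J₀ ≤ p → p.FG) {J : Ideal R} (hJ : J₀ ≤ J) : J.FG := by
  have : IsNoetherianRing (R ⧸ J₀) := IsNoetherianRing.of_prime fun p hp => by
    rw [← Ideal.map_comap_of_surjective _ Ideal.Quotient.mk_surjective p]
    refine (h _ (Ideal.comap_isPrime _ p) ?_).map _
    intro x hx
    rw [Ideal.mem_comap, Ideal.Quotient.eq_zero_iff_mem.2 hx]
    exact p.zero_mem
  refine Submodule.fg_of_fg_map_of_fg_inf_ker (J₀.mkQ) ?_ ?_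
  · have hfg : (J.map (Ideal.Quotient.mk J₀)).FG := IsNoetherian.noetherian _
    have h1 : (Submodule.restrictScalars R (J.map (Ideal.Quotient.mk J₀))).FG :=
      Submodule.FG.restrictScalars_of_surjective hfg Ideal.Quotient.mk_surjective
    have e : Submodule.map J₀.mkQ J =
        Submodule.restrictScalars R (J.map (Ideal.Quotient.mk J₀)) := by
      ext x
      rw [Submodule.mem_map, Submodule.restrictScalars_mem,
        Ideal.mem_map_iff_of_surjective _ Ideal.Quotient.mk_surjective]
      rfl
    rwa [e]
  · rwa [Submodule.ker_mkQ, inf_eq_right.2 hJ]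

theorem isNoetherianRing_of_telescope {ι : Type*} [Fintype ι] (s : ι → R)
    (hmax : (Ideal.span (Set.range s)).IsMaximal)
    (hsurj : ∀ i, Function.Surjective (telescope (s i) R))
    (hsep : ∀ i, ∀ x : R, (∀ n, s i ^ n ∣ x) → x = 0) : IsNoetherianRing R := by
  classical
  -- The generators are removed one at a time. To pass from ideals containing s(t) and s(a) to those
  -- containing s(t), only primes need checking, and a prime avoiding s(a) is handled by
  -- `fg_of_prime_of_notMem`. The start is an ideal containing the maximal ideal.
  have key (t : Finset ι) : (∀ J : Ideal R, Ideal.span (s '' t) ≤ J → J.FG) → ∀ J : Ideal R, J.FG := by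
    induction t using Finset.induction_on with
    | empty => exact fun h J => h J (by simp)
    | insert a t ha ih =>
      refine fun h => ih fun J => fg_of_prime_fg ?_ ?_
      · exact ⟨t.image s, by simp⟩
      · intro p hp hle
        have hins {q : Ideal R} (h1 : Ideal.span (s '' t) ≤ q) (h2 : s a ∈ q) : q.FG := by
          refine h q ?_
          rw [Ideal.span_le] at h1 ⊢
          rintro _ ⟨i, hi, rfl⟩
          rcases Finset.mem_insert.1 hi with rfl | hi
          · exact h2
          · exact h1 ⟨i, hi, rfl⟩
        by_cases hsa : s a ∈ p
        · exact hins hle hsa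
        · exact fg_of_prime_of_notMem (hsurj a) (hsep a) hsa
            (hins (hle.trans le_sup_left) (le_sup_right (a := p) (Ideal.mem_span_singleton_self _)))
  refine ⟨key Finset.univ fun J hJ => ?_⟩
  rw [Finset.coe_univ, Set.image_univ] at hJ
  by_cases hJt : J = ⊤
  · exact hJt.symm ▸ Ideal.fg_top R
  · rw [← hmax.eq_of_le hJt hJ]
    exact ⟨Finset.univ.image s, by simp⟩

end Noetherian

/-! ### The telescope criterion for contramodules over an ideal -/

section ExtCriterion

open Polynomial

variable {R : Type u} [CommRing R]

/-- If p = sXp, then the constant coefficient of p is zero and each coefficient is s times the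
previous one; s may be a zero divisor. -/
theorem mul_C_mul_X_sub_one_injective (s : R) :
    Function.Injective (LinearMap.mulLeft R (C s * X - 1 : R[X])) := by
  rw [injective_iff_map_eq_zero]
  intro p hp
  rw [LinearMap.mulLeft_apply, sub_mul, one_mul, sub_eq_zero, mul_assoc] at hp
  ext n
  rw [coeff_zero, ← hp]
  induction n with
  | zero => simp
  | succ n ih => rw [coeff_C_mul, coeff_X_mul, ← hp, ih, mul_zero]

/-- The projection `R[X] → R[s⁻¹]`, `X ↦ s⁻¹`. -/
noncomputable def awayProj (s : R) : R[X] →ₗ[R] Localization.Away s :=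
  (Localization.awayEquivAdjoin s).symm.toLinearMap ∘ₗ
    (Ideal.Quotient.mkₐ R (Ideal.span {(C s * X - 1 : R[X])})).toLinearMap

theorem awayProj_surjective (s : R) : Function.Surjective (awayProj s) :=
  (Localization.awayEquivAdjoin s).symm.surjective.comp AdjoinRoot.mk_surjective

theorem awayProj_exact (s : R) :
    Function.Exact (LinearMap.mulLeft R (C s * X - 1 : R[X])) (awayProj s) := by
  intro p
  change (Localization.awayEquivAdjoin s).symm (AdjoinRoot.mk _ p) = 0 ↔
    p ∈ Set.range (fun q => (C s * X - 1 : R[X]) * q)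
  rw [EmbeddingLike.map_eq_zero_iff, AdjoinRoot.mk_eq_zero]
  exact exists_congr fun _ => eq_comm

/-- The presentation of `R[s⁻¹]` as the cokernel of `s X - 1` on `R[X]`. -/
noncomputable abbrev awayComplex (s : R) : ShortComplex (ModuleCat.{u} R) :=
  ModuleCat.shortComplexOfCompEqZero (LinearMap.mulLeft R (C s * X - 1 : R[X])) (awayProj s)
    (awayProj_exact s).linearMap_comp_eq_zero

theorem awayComplex_shortExact (s : R) : (awayComplex s).ShortExact :=
  ModuleCat.shortComplex_shortExact _ (awayProj_exact s) (mul_C_mul_X_sub_one_injective s)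
    (awayProj_surjective s)

instance awayComplex_projective (s : R) : Projective (awayComplex s).X₂ :=
  inferInstanceAs (Projective (ModuleCat.of R R[X]))

/-- The linear map out of `R[X]` with prescribed values on the powers of `X`. -/
noncomputable def ofSequence (R : Type u) [CommRing R] {P : Type*} [AddCommGroup P] [Module R P]
    (q : ℕ → P) : R[X] →ₗ[R] P :=
  (Polynomial.basisMonomials R).constr R q

section

variable {P : Type*} [AddCommGroup P] [Module R P]

theorem ofSequence_X_pow (q : ℕ → P) (n : ℕ) : ofSequence R q (X ^ n) = q n := by
  have := (Polynomial.basisMonomials R).constr_basis R q n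
  rw [coe_basisMonomials] at this
  rwa [← monomial_one_right_eq_X_pow]

theorem ofSequence_eval (φ : R[X] →ₗ[R] P) : ofSequence R (fun n => φ (X ^ n)) = φ :=
  (Polynomial.basisMonomials R).ext fun n => by
    rw [coe_basisMonomials]
    beta_reduce
    rw [monomial_one_right_eq_X_pow, ofSequence_X_pow]

theorem ofSequence_comp_mulLeft (s : R) (q : ℕ → P) :
    ofSequence R q ∘ₗ LinearMap.mulLeft R (C s * X - 1 : R[X]) =
      ofSequence R (-telescope s P q) := by
  rw [← ofSequence_eval (ofSequence R q ∘ₗ LinearMap.mulLeft R (C s * X - 1 : R[X]))]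
  congr 1
  ext n
  rw [LinearMap.comp_apply, LinearMap.mulLeft_apply, sub_mul, one_mul, mul_assoc, ← pow_succ',
    C_mul', map_sub, map_smul, ofSequence_X_pow, ofSequence_X_pow, Pi.neg_apply, telescope_apply,
    neg_sub]

end

/-- Since Hom(R[X], P) is the module of sequences in P, the operator Hom(sX - 1, P) is minus the
telescope. As R[X] is projective, its kernel and cokernel are Hom and Ext¹ out of R[s⁻¹]. -/
theorem telescope_bijective_iff (s : R) (P : ModuleCat.{u} R) :
    (Subsingleton (ModuleCat.of R (Localization.Away s) ⟶ P) ∧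
      Subsingleton (Abelian.Ext.{u} (ModuleCat.of R (Localization.Away s)) P 1)) ↔
    Function.Bijective (telescope s P) := by
  have hS := awayComplex_shortExact s
  constructor
  · rintro ⟨h0, h1⟩
    constructor
    · rw [injective_iff_map_eq_zero]
      intro q hq
      let φ : (awayComplex s).X₂ ⟶ P := ModuleCat.ofHom (ofSequence R q)
      have hφ : (awayComplex s).f ≫ φ = 0 := by
        refine ModuleCat.hom_ext ?_
        change ofSequence R q ∘ₗ LinearMap.mulLeft R (C s * X - 1 : R[X]) = 0
        rw [ofSequence_comp_mulLeft, hq, neg_zero]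
        exact LinearMap.map_zero ((Polynomial.basisMonomials R).constr R).toLinearMap
      obtain ⟨l, hl⟩ := Limits.CokernelCofork.IsColimit.desc' hS.gIsCokernel φ hφ
      have hl0 : l = 0 := h0.elim (α := ((awayComplex s).X₃ ⟶ P)) _ _
      rw [hl0, Limits.comp_zero] at hl
      ext n
      rw [← ofSequence_X_pow (R := R) q n]
      exact (LinearMap.congr_fun (congrArg ModuleCat.Hom.hom hl) (X ^ n)).symm
    · intro a
      let φ : (awayComplex s).X₁ ⟶ P := ModuleCat.ofHom (ofSequence R a)
      obtain ⟨x, hx⟩ := Abelian.Ext.contravariant_sequence_exact₁ hS P (Abelian.Ext.mk₀ φ)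
        (n₁ := 1) rfl (h1.elim _ _)
      obtain ⟨ψ, rfl⟩ := Abelian.Ext.homEquiv₀.symm.surjective x
      change (Abelian.Ext.mk₀ _).comp (Abelian.Ext.mk₀ ψ) _ = _ at hx
      rw [Abelian.Ext.mk₀_comp_mk₀] at hx
      have hx' := (Abelian.Ext.homEquiv₀ (X := (awayComplex s).X₁) (Y := P)).symm.injective hx
      let ψ' : R[X] →ₗ[R] P := ψ.hom
      refine ⟨-fun n => ψ' (X ^ n), ?_⟩
      have e : ψ' ∘ₗ LinearMap.mulLeft R (C s * X - 1 : R[X]) = ofSequence R a :=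
        congrArg ModuleCat.Hom.hom hx'
      rw [← ofSequence_eval ψ', ofSequence_comp_mulLeft] at e
      ext n
      rw [map_neg, ← ofSequence_X_pow (R := R) a n, ← e, ofSequence_X_pow]
  · intro h
    constructor
    · refine subsingleton_of_forall_eq 0 fun (l : (awayComplex s).X₃ ⟶ P) => ?_
      have := hS.epi_g
      rw [← cancel_epi (awayComplex s).g, Limits.comp_zero]
      let φ : R[X] →ₗ[R] P := ((awayComplex s).g ≫ l).hom
      have hφ : φ ∘ₗ LinearMap.mulLeft R (C s * X - 1 : R[X]) = 0 := by
        have : (awayComplex s).f ≫ (awayComplex s).g ≫ l = 0 := by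
          rw [← Category.assoc, (awayComplex s).zero, Limits.zero_comp]
        exact congrArg ModuleCat.Hom.hom this
      have hq : telescope s P (fun n => φ (X ^ n)) = 0 := by
        rw [← ofSequence_eval φ, ofSequence_comp_mulLeft] at hφ
        ext n
        have := LinearMap.congr_fun hφ (X ^ n)
        rwa [ofSequence_X_pow, LinearMap.zero_apply, Pi.neg_apply, neg_eq_zero] at this
      have hq0 := h.1 (hq.trans (map_zero _).symm)
      refine ModuleCat.hom_ext ?_
      change φ = 0
      rw [← ofSequence_eval φ, hq0]
      exact LinearMap.map_zero ((Polynomial.basisMonomials R).constr R).toLinearMap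
    · refine subsingleton_of_forall_eq 0 fun x => ?_
      -- Ext¹(R[X], P) = 0, so every class comes from a map R[X] → P under the connecting map; it
      -- dies once that map extends along sX - 1.
      obtain ⟨y, hy⟩ := Abelian.Ext.contravariant_sequence_exact₃ hS P (n₁ := 1) x
        (Abelian.Ext.eq_zero_of_projective (P := (awayComplex s).X₂) (n := 0) _) (n₀ := 0) rfl
      obtain ⟨φ, rfl⟩ := Abelian.Ext.homEquiv₀.symm.surjective y
      let φ' : R[X] →ₗ[R] P := φ.hom
      obtain ⟨q, hq⟩ := h.2 (-fun n => φ' (X ^ n))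
      have e : (awayComplex s).f ≫ ModuleCat.ofHom (ofSequence R q) = φ := by
        refine ModuleCat.hom_ext ?_
        change ofSequence R q ∘ₗ LinearMap.mulLeft R (C s * X - 1 : R[X]) = φ'
        rw [ofSequence_comp_mulLeft, hq, neg_neg, ofSequence_eval]
      rw [← hy, ← e]
      change hS.extClass.comp (Abelian.Ext.mk₀ _) _ = 0
      rw [← Abelian.Ext.mk₀_comp_mk₀, hS.extClass_comp_assoc]

theorem isIContramodule_iff (I : Ideal R) (P : ModuleCat.{u} R) :
    IsIContramodule I P ↔ ∀ s ∈ I, Function.Bijective (telescope s P) :=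
  forall₂_congr fun s _ => telescope_bijective_iff s P

end ExtCriterion

/-! ### Linear algebra over a field -/

section LinearAlgebra

variable {k U V W : Type*} [Field k] [AddCommGroup U] [Module k U] [AddCommGroup V] [Module k V]
  [AddCommGroup W] [Module k W]

theorem exists_comp_eq_of_ker_le (A : V →ₗ[k] W) (x : V →ₗ[k] U)
    (h : LinearMap.ker A ≤ LinearMap.ker x) : ∃ X : W →ₗ[k] U, X ∘ₗ A = x := by
  obtain ⟨L, hL⟩ := LinearMap.exists_leftInverse_of_injective ((LinearMap.ker A).liftQ A le_rfl)
    (Submodule.ker_liftQ_eq_bot' _ _ rfl)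
  refine ⟨(LinearMap.ker A).liftQ x h ∘ₗ L, ?_⟩
  ext v
  have := LinearMap.congr_fun hL ((LinearMap.ker A).mkQ v)
  rw [LinearMap.comp_apply, Submodule.mkQ_apply, Submodule.liftQ_apply] at this
  rw [LinearMap.comp_apply, LinearMap.comp_apply, this]
  rfl

/-- This is the injectivity of vector spaces, and the source of all closedness and duality
statements below. -/
theorem exists_eq_sum_comp_of_ker_le {ι : Type*} [Fintype ι] (A : ι → V →ₗ[k] W)
    (x : V →ₗ[k] U) (h : ∀ v, (∀ i, A i v = 0) → x v = 0) :
    ∃ X : ι → W →ₗ[k] U, x = ∑ i, X i ∘ₗ A i := by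
  classical
  obtain ⟨X, hX⟩ := exists_comp_eq_of_ker_le (LinearMap.pi A) x fun v hv =>
    h v fun i => congrFun hv i
  refine ⟨fun i => X ∘ₗ LinearMap.single k (fun _ => W) i, ?_⟩
  rw [← hX]
  ext v
  simp only [LinearMap.comp_apply, LinearMap.sum_apply]
  rw [← map_sum]
  congr 1
  exact (LinearMap.sum_single_apply _ _).symm

theorem eq_zero_of_forall_lid_rTensor {t : V ⊗[k] W}
    (h : ∀ f : V →ₗ[k] k, TensorProduct.lid k W (LinearMap.rTensor W f t) = 0) : t = 0 := by
  classical
  let b := Module.Basis.ofVectorSpace k V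
  refine (TensorProduct.equivFinsuppOfBasisLeft b).map_eq_zero_iff.1 (Finsupp.ext fun i => ?_)
  have e : ∀ t : V ⊗[k] W, TensorProduct.equivFinsuppOfBasisLeft b t i =
      TensorProduct.lid k W (LinearMap.rTensor W (b.coord i) t) := fun t => by
    induction t using TensorProduct.induction_on with
    | zero => simp
    | add x y hx hy => simp only [map_add, Finsupp.add_apply, hx, hy]
    | tmul x y => simp
  rw [e, h, Finsupp.zero_apply]

theorem eq_of_forall_lid_rTensor {t t' : V ⊗[k] W}
    (h : ∀ f : V →ₗ[k] k, TensorProduct.lid k W (LinearMap.rTensor W f t) =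
      TensorProduct.lid k W (LinearMap.rTensor W f t')) : t = t' := by
  rw [← sub_eq_zero]
  refine eq_zero_of_forall_lid_rTensor fun f => ?_
  rw [map_sub, map_sub, h, sub_self]

theorem lid_rTensor_lTensor_apply (f : V →ₗ[k] k) (g : W →ₗ[k] U) (t : V ⊗[k] W) :
    TensorProduct.lid k U (LinearMap.rTensor U f (LinearMap.lTensor V g t)) =
      g (TensorProduct.lid k W (LinearMap.rTensor W f t)) := by
  induction t using TensorProduct.induction_on with
  | zero => simp
  | add x y hx hy => simp only [map_add, hx, hy]
  | tmul x y => simp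

end LinearAlgebra

/-! ### The dual algebra acting on the coalgebra -/

namespace DualAlgebra

section Action

variable {k C : Type u} [Field k] [AddCommGroup C] [Module k C] [Coalgebra k C]

/-- The element of the dual algebra with a given underlying functional. -/
def ofFn (f : C →ₗ[k] k) : DualAlgebra k C := MulOpposite.op (WithConv.toConv f)

@[simp] theorem fn_ofFn (f : C →ₗ[k] k) : (ofFn f).fn = f := rfl

theorem fn_injective {f g : DualAlgebra k C} (h : f.fn = g.fn) : f = g :=
  MulOpposite.unop_injective (WithConv.ofConv_injective h)

theorem fn_sub (f g : DualAlgebra k C) : (f - g).fn = f.fn - g.fn := rfl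

theorem fn_smul (a : k) (f : DualAlgebra k C) : (a • f).fn = a • f.fn := rfl

theorem fn_algebraMap (a : k) : (algebraMap k (DualAlgebra k C) a).fn = a • Coalgebra.counit (R := k) (A := C) := by
  rw [Algebra.algebraMap_eq_smul_one, fn_smul, fn_one]

theorem eq_zero_of_fn {c : C} (h : ∀ f : DualAlgebra k C, f.fn c = 0) : c = 0 :=
  (Module.forall_dual_apply_eq_zero_iff k c).1 fun f => h (ofFn f)

theorem eq_of_fn {c d : C} (h : ∀ f : DualAlgebra k C, f.fn c = f.fn d) : c = d :=
  sub_eq_zero.1 (eq_zero_of_fn fun f : DualAlgebra k C => by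
    rw [map_sub f.fn, h, sub_self])

/-- The action `c ↦ r(c₍₁₎) c₍₂₎` of the dual algebra on the coalgebra. -/
def act (r : DualAlgebra k C) : C →ₗ[k] C :=
  (TensorProduct.lid k C).toLinearMap ∘ₗ LinearMap.rTensor C r.fn ∘ₗ Coalgebra.comul

theorem act_apply (r : DualAlgebra k C) (c : C) :
    act r c = TensorProduct.lid k C (LinearMap.rTensor C r.fn (Coalgebra.comul c)) := rfl

/-- The opposite convolution order makes `act` a left action; multiplication by r on functionals is
the transpose of `act r`. -/
theorem fn_act (h r : DualAlgebra k C) (c : C) : h.fn (act r c) = (h * r).fn c := by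
  rw [fn_mul, act_apply, LinearMap.comp_apply, LinearMap.comp_apply]
  generalize (Coalgebra.comul (R := k) c) = d
  induction d using TensorProduct.induction_on with
  | zero => simp
  | add x y hx hy => simp only [map_add, hx, hy]
  | tmul x y => simp

theorem fn_comp_act (h r : DualAlgebra k C) : h.fn ∘ₗ act r = (h * r).fn :=
  LinearMap.ext (fn_act h r)

theorem counit_act (r : DualAlgebra k C) (c : C) : Coalgebra.counit (R := k) (A := C) (act r c) = r.fn c := by
  rw [← fn_one, fn_act, one_mul]

theorem act_one : act (1 : DualAlgebra k C) = LinearMap.id :=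
  LinearMap.ext fun c => eq_of_fn fun h => by rw [fn_act, mul_one, LinearMap.id_apply]

theorem act_zero : act (0 : DualAlgebra k C) = 0 :=
  LinearMap.ext fun c => eq_of_fn fun h => by rw [fn_act, mul_zero]; simp [fn_zero]

theorem act_add (r s : DualAlgebra k C) : act (r + s) = act r + act s :=
  LinearMap.ext fun c => eq_of_fn fun h => by
    rw [fn_act, mul_add, fn_add, LinearMap.add_apply, LinearMap.add_apply, map_add, fn_act, fn_act]

theorem act_sub (r s : DualAlgebra k C) : act (r - s) = act r - act s :=
  map_sub (⟨⟨act, act_zero⟩, act_add⟩ : DualAlgebra k C →+ (C →ₗ[k] C)) r s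

theorem act_sum {ι : Type*} (t : Finset ι) (r : ι → DualAlgebra k C) :
    act (∑ i ∈ t, r i) = ∑ i ∈ t, act (r i) :=
  map_sum (⟨⟨act, act_zero⟩, act_add⟩ : DualAlgebra k C →+ (C →ₗ[k] C)) r t

theorem act_algebraMap (a : k) (c : C) : act (algebraMap k (DualAlgebra k C) a) c = a • c :=
  eq_of_fn fun h => by
    rw [fn_act, ← Algebra.commutes, ← Algebra.smul_def, fn_smul, LinearMap.smul_apply, map_smul]

theorem act_mul (r s : DualAlgebra k C) : act (r * s) = act r ∘ₗ act s :=
  LinearMap.ext fun c => eq_of_fn fun h => by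
    rw [fn_act, LinearMap.comp_apply, fn_act, fn_act, mul_assoc]

theorem act_mul_apply (r s : DualAlgebra k C) (c : C) : act (r * s) c = act r (act s c) :=
  LinearMap.congr_fun (act_mul r s) c

theorem act_sum_apply {ι : Type*} (t : Finset ι) (r : ι → DualAlgebra k C) (c : C) :
    act (∑ i ∈ t, r i) c = ∑ i ∈ t, act (r i) c := by
  rw [act_sum, LinearMap.sum_apply]

end Action

/-! ### Annihilators of ideals and closedness of finitely generated ideals -/

section Cocommutative

variable {k C : Type u} [Field k] [AddCommGroup C] [Module k C] [Coalgebra k C]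
  [Coalgebra.IsCocomm k C]

theorem act_comm (r s : DualAlgebra k C) (c : C) : act r (act s c) = act s (act r c) := by
  rw [← act_mul_apply, mul_comm, act_mul_apply]

/-- By definition the action uses the first tensor leg; commutativity of the dual algebra lets it be
moved to the second. -/
theorem comul_act (r : DualAlgebra k C) (c : C) :
    Coalgebra.comul (R := k) (act r c) = LinearMap.lTensor C (act r) (Coalgebra.comul c) := by
  refine eq_of_forall_lid_rTensor fun f => ?_
  rw [lid_rTensor_lTensor_apply]
  exact act_comm (ofFn f) r c

variable (k C) in
/-- Ideals of the dual algebra, viewed as a commutative ring. -/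
abbrev DualIdeal : Type u := @Ideal (DualAlgebra k C) CommSemiring.toSemiring

/-- The elements of the coalgebra annihilated by an ideal of the dual algebra. -/
def perp (J : DualIdeal k C) : Submodule k C where
  carrier := {c | ∀ h ∈ J, h.fn c = 0}
  add_mem' hc hd h hh := by rw [map_add, hc h hh, hd h hh, add_zero]
  zero_mem' h _ := map_zero _
  smul_mem' a c hc h hh := by rw [map_smul, hc h hh, smul_zero]

theorem act_eq_zero_of_mem_perp {J : DualIdeal k C} {c : C} (hc : c ∈ perp J)
    {r : DualAlgebra k C} (hr : r ∈ J) : act r c = 0 :=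
  eq_zero_of_fn fun h => by rw [fn_act]; exact hc _ (J.mul_mem_left h hr)

theorem mem_perp_span_range {ι : Type*} {s : ι → DualAlgebra k C} {c : C}
    (h : ∀ i, act (s i) c = 0) : c ∈ perp (Ideal.span (Set.range s)) := by
  intro f hf
  have key : act f c = 0 := by
    induction hf using Submodule.span_induction with
    | mem x hx => obtain ⟨i, rfl⟩ := hx; exact h i
    | zero => rw [act_zero, LinearMap.zero_apply]
    | add x y _ _ hx hy => rw [act_add, LinearMap.add_apply, hx, hy, add_zero]
    | smul a x _ hx => rw [smul_eq_mul, act_mul_apply, hx, map_zero]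
  rw [← counit_act, key, map_zero]

theorem act_mem_perp {I : DualIdeal k C} {n : ℕ} {c : C} (hc : c ∈ perp (I ^ (n + 1)))
    {f : DualAlgebra k C} (hf : f ∈ I) : act f c ∈ perp (I ^ n) := fun h hh => by
  rw [fn_act]
  exact hc _ (by rw [pow_succ]; exact Ideal.mul_mem_mul hh hf)

/-- A finitely generated ideal is closed. -/
theorem mem_span_range_of_perp {ι : Type*} [Fintype ι] {s : ι → DualAlgebra k C}
    {r : DualAlgebra k C} (h : ∀ c ∈ perp (Ideal.span (Set.range s)), r.fn c = 0) :
    r ∈ Ideal.span (Set.range s) := by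
  -- The common kernel of the operators `act (s i)` lies in the annihilator of the ideal, so r = ∑
  -- Xᵢ ∘ act sᵢ, which is ∑ Xᵢ * sᵢ in the dual algebra.
  obtain ⟨X, hX⟩ := exists_eq_sum_comp_of_ker_le (fun i => act (s i)) r.fn
    fun v hv => h v (mem_perp_span_range hv)
  refine Ideal.mem_span_range_iff_exists_fun.2 ⟨fun i => ofFn (X i), fn_injective ?_⟩
  rw [hX]
  ext c
  rw [← counit_act, act_sum_apply]
  simp only [map_sum, counit_act, LinearMap.sum_apply]
  exact Finset.sum_congr rfl fun i _ => by rw [← fn_act]; rfl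

theorem mem_of_fg_of_perp {J : DualIdeal k C} (hJ : J.FG)
    {r : DualAlgebra k C} (h : ∀ c ∈ perp J, r.fn c = 0) : r ∈ J := by
  obtain ⟨n, s, rfl⟩ := Submodule.fg_iff_exists_fin_generating_family.1 hJ
  exact mem_span_range_of_perp h

end Cocommutative

/-! ### The augmentation ideal -/

section Augmentation

variable {k C : Type u} [Field k] [AddCommGroup C] [Module k C] [Coalgebra k C]

theorem comul_coaug (γ : k →ₗc[k] C) : Coalgebra.comul (R := k) (γ 1) = γ 1 ⊗ₜ[k] γ 1 := by
  have h := LinearMap.congr_fun γ.map_comp_comul 1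
  simp only [LinearMap.comp_apply] at h
  refine Eq.trans h.symm ?_
  simp

theorem counit_coaug (γ : k →ₗc[k] C) (a : k) : Coalgebra.counit (R := k) (A := C) (γ a) = a := by
  simp

/-- The augmentation of the dual algebra. -/
def aug (γ : k →ₗc[k] C) : DualAlgebra k C →+* k where
  toFun f := f.fn (γ 1)
  map_one' := by rw [fn_one, counit_coaug]
  map_mul' f g := by
    rw [fn_mul, LinearMap.comp_apply, LinearMap.comp_apply, comul_coaug]
    simp [mul_comm]
  map_zero' := rfl
  map_add' _ _ := rfl

theorem act_coaug (γ : k →ₗc[k] C) (r : DualAlgebra k C) : act r (γ 1) = r.fn (γ 1) • γ 1 := by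
  rw [act_apply, comul_coaug]; simp

variable [Coalgebra.IsCocomm k C]

/-- The augmentation ideal of the dual algebra. -/
noncomputable def augIdeal (γ : k →ₗc[k] C) : DualIdeal k C := RingHom.ker (aug γ)

variable {γ : k →ₗc[k] C}

theorem mem_augIdeal {f : DualAlgebra k C} : f ∈ augIdeal γ ↔ f.fn (γ 1) = 0 := Iff.rfl

theorem sub_algebraMap_mem (f : DualAlgebra k C) :
    f - algebraMap k (DualAlgebra k C) (f.fn (γ 1)) ∈ augIdeal γ := by
  rw [mem_augIdeal, fn_sub, fn_algebraMap, LinearMap.sub_apply, LinearMap.smul_apply,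
    counit_coaug, smul_eq_mul, mul_one, sub_self]

instance augIdeal_isMaximal : (augIdeal γ).IsMaximal := by
  refine RingHom.ker_isMaximal_of_surjective (aug γ) fun a => ⟨algebraMap k _ a, ?_⟩
  change (algebraMap k (DualAlgebra k C) a).fn (γ 1) = a
  rw [fn_algebraMap, LinearMap.smul_apply, counit_coaug, smul_eq_mul, mul_one]

theorem mem_perp_augIdeal {c : C} :
    c ∈ perp (augIdeal γ) ↔ c = Coalgebra.counit (R := k) (A := C) c • γ 1 := by
  constructor
  · intro hc
    refine eq_of_fn fun f : DualAlgebra k C => ?_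
    have := hc _ (sub_algebraMap_mem f)
    rw [fn_sub, fn_algebraMap, LinearMap.sub_apply, sub_eq_zero] at this
    rw [this, LinearMap.smul_apply, map_smul, smul_eq_mul, smul_eq_mul, mul_comm]
  · intro hc h hh
    rw [hc, map_smul, mem_augIdeal.1 hh, smul_zero]

/-- A functional in the augmentation ideal descends to D = C/γ(k), and a product of n + 1 such
functionals is a tensor functional evaluated on μ⁽ⁿ⁾. -/
theorem exists_iteratedComul_comp_eq (n : ℕ) {h : DualAlgebra k C} (hh : h ∈ augIdeal γ ^ (n + 1)) :
    ∃ ψ : TensorPower k (n + 1) (CoaugQuotient γ) →ₗ[k] k,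
      h.fn = ψ ∘ₗ iteratedComul γ n ∘ₗ (LinearMap.range γ.toLinearMap).mkQ := by
  have hlift {a : DualAlgebra k C} (ha : a ∈ augIdeal γ) :
      ∃ b : CoaugQuotient γ →ₗ[k] k, a.fn = b ∘ₗ (LinearMap.range γ.toLinearMap).mkQ := by
    refine ⟨Submodule.liftQ _ a.fn ?_, (Submodule.liftQ_mkQ _ _ _).symm⟩
    rintro _ ⟨x, rfl⟩
    have e : γ x = x • γ 1 := by rw [← map_smul, smul_eq_mul, mul_one]
    change a.fn (γ x) = 0
    rw [e, map_smul, mem_augIdeal.1 ha, smul_zero]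
  induction n generalizing h with
  | zero =>
    rw [zero_add, pow_one] at hh
    obtain ⟨b, hb⟩ := hlift hh
    refine ⟨b ∘ₗ (PiTensorProduct.subsingletonEquiv (R := k)
      (s := fun _ => CoaugQuotient γ) (0 : Fin 1)).toLinearMap, ?_⟩
    rw [hb]
    ext c
    exact (congrArg b (LinearEquiv.apply_symm_apply _ _)).symm
  | succ n ih =>
    rw [pow_succ] at hh
    induction hh using Submodule.mul_induction_on' with
    | mem_mul_mem a ha b hb =>
      obtain ⟨ψ, hψ⟩ := ih ha
      obtain ⟨b', hb'⟩ := hlift hb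
      refine ⟨LinearMap.mul' k k ∘ₗ TensorProduct.map ψ (b' ∘ₗ
        (PiTensorProduct.subsingletonEquiv (R := k)
          (s := fun _ => CoaugQuotient γ) (0 : Fin 1)).toLinearMap) ∘ₗ
        TensorPower.mulEquiv.symm.toLinearMap, ?_⟩
      -- The product is opposite to convolution, whereas `iteratedComul` iterates on the left leg;
      -- swapping the factors puts a on that leg.
      rw [mul_comm, fn_mul, hψ, hb', iteratedComul]
      ext c
      simp only [LinearMap.comp_apply, LinearEquiv.coe_coe, LinearEquiv.symm_apply_apply,
        Submodule.mkQ_apply, reducedComul, Submodule.liftQ_apply]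
      generalize (Coalgebra.comul (R := k) c) = d
      induction d using TensorProduct.induction_on with
      | zero => simp
      | add x y hx hy => simp only [map_add, hx, hy]
      | tmul x y =>
        rw [TensorProduct.map_tmul, TensorProduct.map_tmul, TensorProduct.map_tmul,
          TensorProduct.map_tmul]
        simp only [LinearMap.mul'_apply, LinearMap.comp_apply, LinearEquiv.coe_coe,
          LinearEquiv.apply_symm_apply]
    | add x _ y _ hx hy =>
      obtain ⟨ψ, hψ⟩ := hx
      obtain ⟨ψ', hψ'⟩ := hy
      exact ⟨ψ + ψ', by rw [fn_add, hψ, hψ', LinearMap.add_comp]⟩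

theorem exists_mem_perp_pow (hconil : IsConilpotent γ) (c : C) :
    ∃ n, c ∈ perp (augIdeal γ ^ n) := by
  obtain ⟨n, -, hn⟩ := hconil ((LinearMap.range γ.toLinearMap).mkQ c)
  refine ⟨n + 1, fun h hh => ?_⟩
  obtain ⟨ψ, hψ⟩ := exists_iteratedComul_comp_eq n hh
  rw [hψ, LinearMap.comp_apply, LinearMap.comp_apply, hn, map_zero]

end Augmentation

end DualAlgebra

/-! ### Primitive elements and `Ext¹` -/

namespace LeftComodule

variable {k C : Type u} [Field k] [AddCommGroup C] [Module k C] [Coalgebra k C]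

variable (k C) in
/-- The coalgebra as a left comodule over itself. -/
def regular : LeftComodule k C where
  carrier := C
  coact := Coalgebra.comul
  coassoc := Coalgebra.coassoc
  counit_coact := by
    rw [Coalgebra.rTensor_counit_comp_comul]
    ext
    simp

variable (γ : k →ₗc[k] C)

/-- The coaugmentation as a morphism of left comodules. -/
def coaugHom : trivial γ ⟶ regular k C :=
  (⟨γ.toLinearMap, by
    refine LinearMap.ext_ring ?_
    change Coalgebra.comul (R := k) (γ 1) =
      LinearMap.lTensor C γ.toLinearMap ((TensorProduct.rid k C).symm (γ 1))
    rw [DualAlgebra.comul_coaug, TensorProduct.rid_symm_apply, LinearMap.lTensor_tmul]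
    rfl⟩ : Hom (trivial γ) (regular k C))

theorem coaugHom_injective : Function.Injective (linMap (coaugHom γ)) :=
  Function.LeftInverse.injective (g := Coalgebra.counit (R := k) (A := C))
    (DualAlgebra.counit_coaug γ)

/-- The short exact sequence `0 → k → C → C / k → 0` of left comodules. -/
noncomputable abbrev coaugComplex : ShortComplex (LeftComodule k C) :=
  ShortComplex.mk (coaugHom γ) (cokerπ (coaugHom γ)) (comp_cokerπ _)

theorem coaugComplex_shortExact : (coaugComplex γ).ShortExact where
  exact := ShortComplex.exact_of_f_is_kernel _ (isLimitOfInjective (coaugHom γ)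
    (cokerπ (coaugHom γ)) (comp_cokerπ _) (coaugHom_injective γ)
    (le_of_eq (Submodule.ker_mkQ _)))
  mono_f := mono_of_injective _ (coaugHom_injective γ)
  epi_g := epi_of_surjective _ (cokerπ_surjective _)

/-- The elements `m` of a comodule with the coaction `m ↦ γ(1) ⊗ m`. -/
def invariants (M : LeftComodule k C) : Submodule k M.carrier :=
  LinearMap.ker (M.coact - TensorProduct.mk k C M.carrier (γ 1))

variable {γ} in
theorem mem_invariants {M : LeftComodule k C} {m : M.carrier} :
    m ∈ invariants γ M ↔ M.coact m = γ 1 ⊗ₜ[k] m := by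
  rw [invariants, LinearMap.mem_ker, LinearMap.sub_apply, sub_eq_zero]
  rfl

/-- The morphism from the trivial comodule determined by an invariant element. -/
def homOfInvariant (M : LeftComodule k C) : invariants γ M →ₗ[k] (trivial γ ⟶ M) where
  toFun m := (⟨LinearMap.toSpanSingleton k M.carrier m, by
    refine LinearMap.ext_ring ?_
    change M.coact ((1 : k) • (m : M.carrier)) =
      LinearMap.lTensor C (LinearMap.toSpanSingleton k M.carrier (m : M.carrier))
        ((TensorProduct.rid k C).symm (γ 1))
    rw [one_smul, mem_invariants.1 m.2, TensorProduct.rid_symm_apply, LinearMap.lTensor_tmul,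
      LinearMap.toSpanSingleton_apply, one_smul]⟩ : Hom (trivial γ) M)
  map_add' m n := linMap_injective (LinearMap.toSpanSingleton_add (R := k) _ _)
  map_smul' a m := linMap_injective (LinearMap.toSpanSingleton_smul (R := k) _ _)

theorem linMap_homOfInvariant_one (M : LeftComodule k C) (m : invariants γ M) :
    linMap (homOfInvariant γ M m) (1 : k) = m := one_smul k (m : M.carrier)

theorem eq_smul_coaug_of_comul {c : C} (h : Coalgebra.comul (R := k) c = γ 1 ⊗ₜ[k] c) :
    c = Coalgebra.counit (R := k) (A := C) c • γ 1 :=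
  DualAlgebra.eq_of_fn fun f : DualAlgebra k C => by
    rw [← DualAlgebra.counit_act f c, DualAlgebra.act_apply, h]
    simp [mul_comm]

theorem hom_regular_one (φ : trivial γ ⟶ regular k C) :
    linMap φ (1 : k) ∈ LinearMap.range (linMap (coaugHom γ)) := by
  have h := LinearMap.congr_fun (linMap_comm φ) (1 : k)
  have h1 : Coalgebra.comul (R := k) (A := C) (linMap φ (1 : k)) = γ 1 ⊗ₜ[k] (linMap φ (1 : k)) := by
    refine h.trans ?_
    change LinearMap.lTensor C (linMap φ) ((TensorProduct.rid k C).symm (γ 1)) = _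
    rw [TensorProduct.rid_symm_apply]
    exact LinearMap.lTensor_tmul _ _ _ _
  refine ⟨Coalgebra.counit (R := k) (A := C) (linMap φ (1 : k)), ?_⟩
  refine Eq.trans ?_ (eq_smul_coaug_of_comul γ h1).symm
  change γ _ = _
  rw [← map_smul, smul_eq_mul, mul_one]

variable {γ} in
-- The connecting map Hom(k, C/k) → Ext¹(k, k) is injective, because every morphism k → C lands in
-- γ(k) (`hom_regular_one`) and so vanishes in C/k.
theorem finite_invariants_coker (hfin : IsFinitelyCogenerated γ) :
    Module.Finite k (invariants γ (coker (coaugHom γ))) := by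
  let _ : HasExt.{u + 1} (LeftComodule k C) := HasExt.standard _
  have hfin' : Module.Finite k
    (Abelian.Ext.{u + 1} (LeftComodule.trivial γ) (LeftComodule.trivial γ) 1) := hfin
  have hS := coaugComplex_shortExact γ
  let δ : invariants γ (coker (coaugHom γ)) →ₗ[k]
      Abelian.Ext.{u + 1} (LeftComodule.trivial γ) (LeftComodule.trivial γ) 1 :=
    { toFun m := (Abelian.Ext.mk₀ (homOfInvariant γ _ m)).comp hS.extClass (zero_add 1)
      map_add' m n := by rw [map_add, Abelian.Ext.mk₀_add, Abelian.Ext.add_comp]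
      map_smul' a m := by
        rw [map_smul, Abelian.Ext.mk₀_smul, Abelian.Ext.smul_comp, RingHom.id_apply] }
  refine Module.Finite.of_injective δ ?_
  rw [injective_iff_map_eq_zero]
  intro m hm
  obtain ⟨x, hx⟩ := Abelian.Ext.covariant_sequence_exact₃ _ hS _ (zero_add 1) hm
  obtain ⟨φ, rfl⟩ := Abelian.Ext.homEquiv₀.symm.surjective x
  change (Abelian.Ext.mk₀ φ).comp _ _ = _ at hx
  rw [Abelian.Ext.mk₀_comp_mk₀] at hx
  have hx' := Abelian.Ext.homEquiv₀.symm.injective hx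
  ext
  rw [← linMap_homOfInvariant_one, ← hx', linMap_comp]
  exact (Submodule.Quotient.mk_eq_zero _).2 (hom_regular_one γ φ)

end LeftComodule

/-! ### Finitely many generators of the augmentation ideal -/

namespace DualAlgebra

variable {k C : Type u} [Field k] [AddCommGroup C] [Module k C] [Coalgebra k C]
  [Coalgebra.IsCocomm k C] {γ : k →ₗc[k] C}

theorem fn_mkQ_eq_zero_iff {c : C} :
    (LinearMap.range γ.toLinearMap).mkQ c = 0 ↔ c ∈ perp (augIdeal γ) := by
  rw [Submodule.mkQ_apply, Submodule.Quotient.mk_eq_zero, mem_perp_augIdeal]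
  constructor
  · rintro ⟨a, rfl⟩
    change γ a = Coalgebra.counit (R := k) (A := C) (γ a) • γ 1
    rw [counit_coaug, ← map_smul, smul_eq_mul, mul_one]
  · intro h
    refine ⟨Coalgebra.counit (R := k) (A := C) c, ?_⟩
    change γ _ = _
    conv_rhs => rw [h]
    rw [← map_smul, smul_eq_mul, mul_one]

/-- For every functional f, the element f - f(γ1) lies in I, so it sends c into the annihilator of
I, which is γ(k). Thus f acts on the class of c by the scalar f(γ1), and functionals separate
tensors. -/
theorem mkQ_mem_invariants {c : C} (hc : c ∈ perp (augIdeal γ ^ 2)) :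
    (LinearMap.range γ.toLinearMap).mkQ c ∈
      LeftComodule.invariants γ (LeftComodule.coker (LeftComodule.coaugHom γ)) := by
  refine LeftComodule.mem_invariants.2 ?_
  change LinearMap.lTensor C (LinearMap.range γ.toLinearMap).mkQ (Coalgebra.comul c) = _
  refine eq_of_forall_lid_rTensor fun f => ?_
  rw [lid_rTensor_lTensor_apply]
  change (LinearMap.range γ.toLinearMap).mkQ (act (ofFn f) c) = TensorProduct.lid k _
    (LinearMap.rTensor _ f (γ 1 ⊗ₜ[k] (LinearMap.range γ.toLinearMap).mkQ c))
  rw [LinearMap.rTensor_tmul, TensorProduct.lid_tmul, ← map_smul, ← sub_eq_zero, ← map_sub,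
    fn_mkQ_eq_zero_iff]
  have h := act_mem_perp (n := 1) hc (sub_algebraMap_mem (γ := γ) (ofFn f))
  rwa [pow_one, act_sub, LinearMap.sub_apply, act_algebraMap] at h

/-- The functionals extend the coordinates on the finite-dimensional space of invariants of C/γ(k),
which contains the image of the annihilator of I². -/
theorem exists_separating (hfin : IsFinitelyCogenerated γ) :
    ∃ (m : ℕ) (s : Fin m → DualAlgebra k C), (∀ i, s i ∈ augIdeal γ) ∧
      ∀ c ∈ perp (augIdeal γ ^ 2), (∀ i, (s i).fn c = 0) → c ∈ perp (augIdeal γ) := by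
  have := LeftComodule.finite_invariants_coker hfin
  let W := LeftComodule.invariants γ (LeftComodule.coker (LeftComodule.coaugHom γ))
  let b := Module.finBasis k W
  choose f hf using fun i => LinearMap.exists_extend (b.coord i)
  let s (i : Fin (Module.finrank k W)) : DualAlgebra k C :=
    ofFn (f i ∘ₗ (LinearMap.range γ.toLinearMap).mkQ)
  refine ⟨_, s, fun i => ?_, fun c hc hs => ?_⟩
  · have h0 : (LinearMap.range γ.toLinearMap).mkQ (γ 1) = 0 :=
      (Submodule.Quotient.mk_eq_zero _).2 ⟨1, rfl⟩
    change f i ((LinearMap.range γ.toLinearMap).mkQ (γ 1)) = 0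
    rw [h0]
    exact map_zero (f i)
  · rw [← fn_mkQ_eq_zero_iff]
    let w : W := ⟨_, mkQ_mem_invariants hc⟩
    have hw : w = 0 := b.ext_elem fun i => by
      rw [map_zero, Finsupp.zero_apply]
      exact (LinearMap.congr_fun (hf i) w).symm.trans (hs i)
    exact congrArg Subtype.val hw

/-- In a finitely cogenerated conilpotent coalgebra, finitely many elements of the augmentation
ideal detect the coaugmentation. -/
theorem exists_detecting (hconil : IsConilpotent γ) (hfin : IsFinitelyCogenerated γ) :
    ∃ (m : ℕ) (s : Fin m → DualAlgebra k C), (∀ i, s i ∈ augIdeal γ) ∧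
      ∀ c, (∀ i, act (s i) c = 0) → c ∈ perp (augIdeal γ) := by
  obtain ⟨m, s, hs, hsep⟩ := exists_separating hfin
  refine ⟨m, s, hs, fun c hc => ?_⟩
  obtain ⟨n, hn⟩ := exists_mem_perp_pow hconil c
  induction n generalizing c with
  | zero =>
    intro h _
    exact hn h (by rw [pow_zero, Ideal.one_eq_top]; exact Submodule.mem_top)
  | succ n ih =>
    -- It suffices that I² kills c. For b in I, the element b · c is killed by Iⁿ and still by every
    -- sᵢ, since the actions commute, so by induction it is killed by I.
    refine hsep c (fun h hh => ?_) fun i => by rw [← counit_act, hc, map_zero]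
    rw [pow_two] at hh
    induction hh using Submodule.mul_induction_on' with
    | mem_mul_mem a ha b hb =>
      rw [← fn_act]
      refine ih _ (fun i => ?_) (act_mem_perp hn hb) a ha
      rw [act_comm, hc, map_zero]
    | add x _ y _ hx hy => rw [fn_add, LinearMap.add_apply, hx, hy, add_zero]

theorem exists_span_eq_augIdeal (hconil : IsConilpotent γ) (hfin : IsFinitelyCogenerated γ) :
    ∃ (m : ℕ) (s : Fin m → DualAlgebra k C), Ideal.span (Set.range s) = augIdeal γ := by
  obtain ⟨m, s, hs, hdet⟩ := exists_detecting hconil hfin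
  refine ⟨m, s, le_antisymm ?_ fun f hf => mem_span_range_of_perp fun c hc => ?_⟩
  · rw [Ideal.span_le]
    rintro _ ⟨i, rfl⟩
    exact hs i
  · exact hdet c (fun i => act_eq_zero_of_mem_perp hc (Ideal.subset_span ⟨i, rfl⟩)) f hf

end DualAlgebra

/-! ### Ring-theoretic properties of the dual algebra -/

namespace DualAlgebra

variable {k C : Type u} [Field k] [AddCommGroup C] [Module k C] [Coalgebra k C]
  [Coalgebra.IsCocomm k C] {γ : k →ₗc[k] C} {V : Type*} [AddCommGroup V] [Module k V]

theorem exists_act_pow_eq_zero (hconil : IsConilpotent γ) {s : DualAlgebra k C}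
    (hs : s ∈ augIdeal γ) (c : C) : ∃ n, ∀ m, n ≤ m → act (s ^ m) c = 0 := by
  obtain ⟨n, hn⟩ := exists_mem_perp_pow hconil c
  exact ⟨n, fun m hm => act_eq_zero_of_mem_perp hn
    (Ideal.pow_le_pow_right hm (Ideal.pow_mem_pow hs m))⟩

/-- The solution is qₙ = ∑ᵢ xₙ₊ᵢ ∘ act(sⁱ), a finite sum at each element of C by conilpotency.
Taking V general gives the telescope equation for all free contramodules Hom(C, V). -/
theorem exists_eq_add_comp_act (hconil : IsConilpotent γ) {s : DualAlgebra k C}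
    (hs : s ∈ augIdeal γ) (x : ℕ → C →ₗ[k] V) :
    ∃ q : ℕ → C →ₗ[k] V, ∀ n, q n - q (n + 1) ∘ₗ act s = x n := by
  have hfin (n : ℕ) {c : C} {N : ℕ} (hN : ∀ m, N ≤ m → act (s ^ m) c = 0) :
      ∑ᶠ i, x (n + i) (act (s ^ i) c) = ∑ i ∈ Finset.range N, x (n + i) (act (s ^ i) c) := by
    refine finsum_eq_sum_of_support_subset _ fun i hi => ?_
    rw [Finset.coe_range, Set.mem_Iio]
    by_contra hlt
    exact hi (by simp only [hN i (not_lt.1 hlt), map_zero])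
  have hsup (n : ℕ) (c : C) : (Function.support fun i => x (n + i) (act (s ^ i) c)).Finite := by
    obtain ⟨N, hN⟩ := exists_act_pow_eq_zero hconil hs c
    refine (Set.finite_Iio N).subset fun i hi => ?_
    by_contra hlt
    exact hi (by simp only [hN i (not_lt.1 hlt), map_zero])
  refine ⟨fun n =>
    { toFun c := ∑ᶠ i, x (n + i) (act (s ^ i) c)
      map_add' c d := by
        simp only [map_add]
        exact finsum_add_distrib (hsup n c) (hsup n d)
      map_smul' a c := by
        simp only [map_smul]
        exact (smul_finsum' a (hsup n c)).symm }, fun n => ?_⟩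
  ext c
  obtain ⟨N, hN⟩ := exists_act_pow_eq_zero hconil hs c
  change ∑ᶠ i, x (n + i) (act (s ^ i) c) - ∑ᶠ i, x (n + 1 + i) (act (s ^ i) (act s c)) = x n c
  have hN' : ∀ m, N ≤ m → act (s ^ m) (act s c) = 0 := fun m hm => by
    rw [act_comm, hN m hm, map_zero]
  rw [hfin n (N := N + 1) fun m hm => hN m (by omega), hfin (n + 1) hN', Finset.sum_range_succ',
    sub_eq_iff_eq_add', pow_zero, act_one, add_zero, LinearMap.id_apply]
  congr 1
  refine Finset.sum_congr rfl fun i _ => ?_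
  rw [← act_mul_apply, ← pow_succ, add_assoc, add_comm 1 i]

theorem eq_zero_of_eq_comp_act (hconil : IsConilpotent γ) {s : DualAlgebra k C}
    (hs : s ∈ augIdeal γ) {z : ℕ → C →ₗ[k] V} (hz : ∀ n, z n = z (n + 1) ∘ₗ act s) (n : ℕ) :
    z n = 0 := by
  ext c
  obtain ⟨N, hN⟩ := exists_act_pow_eq_zero hconil hs c
  have h : ∀ m, z n = z (n + m) ∘ₗ act (s ^ m) := fun m => by
    induction m with
    | zero => rw [pow_zero, act_one]; rfl
    | succ m ih => rw [ih, hz, pow_succ', act_mul]; rfl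
  rw [h N, LinearMap.comp_apply, hN N le_rfl, map_zero, LinearMap.zero_apply]

theorem telescope_dualAlgebra_bijective (hconil : IsConilpotent γ) {s : DualAlgebra k C}
    (hs : s ∈ augIdeal γ) : Function.Bijective (telescope s (DualAlgebra k C)) := by
  constructor
  · rw [injective_iff_map_eq_zero]
    intro q hq
    ext1 n
    refine fn_injective (eq_zero_of_eq_comp_act hconil hs (z := fun n => (q n).fn) (fun n => ?_) n)
    have := sub_eq_zero.1 (congrFun hq n)
    rw [fn_comp_act, this, smul_eq_mul, mul_comm]
  · intro a
    obtain ⟨q, hq⟩ := exists_eq_add_comp_act hconil hs fun n => (a n).fn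
    refine ⟨fun n => ofFn (q n), funext fun n => fn_injective ?_⟩
    rw [telescope_apply, fn_sub, smul_eq_mul, mul_comm, ← fn_comp_act]
    exact hq n

/-- After scaling, f is 1 - h with h in the augmentation ideal, and 1 - h is invertible by the
telescope criterion. -/
theorem isUnit_of_notMem_augIdeal (hconil : IsConilpotent γ) {f : DualAlgebra k C}
    (hf : f ∉ augIdeal γ) : IsUnit f := by
  have hf0 : f.fn (γ 1) ≠ 0 := hf
  set a := f.fn (γ 1) with ha
  let h : DualAlgebra k C := 1 - a⁻¹ • f
  have hh : h ∈ augIdeal γ := by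
    rw [mem_augIdeal, fn_sub, fn_one, fn_smul, LinearMap.sub_apply, LinearMap.smul_apply,
      counit_coaug, ← ha, smul_eq_mul, inv_mul_cancel₀ hf0, sub_self]
  obtain ⟨y, hy⟩ := (one_sub_smul_bijective (telescope_dualAlgebra_bijective hconil hh) 1).2 1
  have hy' : y - (1 - a⁻¹ • f) * y = 1 := hy
  refine IsUnit.of_mul_eq_one (a⁻¹ • y) ?_
  rw [← hy', sub_mul, one_mul, smul_mul_assoc, mul_smul_comm]
  abel

theorem isLocalRing (hconil : IsConilpotent γ) : IsLocalRing (DualAlgebra k C) :=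
  IsLocalRing.of_unique_max_ideal ⟨augIdeal γ, augIdeal_isMaximal, fun J hJ => by
    refine hJ.eq_of_le augIdeal_isMaximal.ne_top fun f hf => ?_
    by_contra hfI
    exact hJ.ne_top (Ideal.eq_top_of_isUnit_mem _ hf (isUnit_of_notMem_augIdeal hconil hfI))⟩

theorem eq_zero_of_forall_mem_pow (hconil : IsConilpotent γ) {f : DualAlgebra k C}
    (h : ∀ n, f ∈ augIdeal γ ^ n) : f = 0 := by
  refine fn_injective (LinearMap.ext fun c => ?_)
  obtain ⟨n, hn⟩ := exists_mem_perp_pow hconil c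
  exact hn f (h n)

theorem isNoetherianRing (hconil : IsConilpotent γ) (hfin : IsFinitelyCogenerated γ) :
    IsNoetherianRing (DualAlgebra k C) := by
  obtain ⟨m, s, hs⟩ := exists_span_eq_augIdeal hconil hfin
  have hsI (i : Fin m) : s i ∈ augIdeal γ := hs ▸ Ideal.subset_span ⟨i, rfl⟩
  refine isNoetherianRing_of_telescope s (hs ▸ augIdeal_isMaximal)
    (fun i => (telescope_dualAlgebra_bijective hconil (hsI i)).2) fun i x hx =>
      eq_zero_of_forall_mem_pow hconil fun n => Ideal.mem_of_dvd _ (hx n)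
        (Ideal.pow_mem_pow (hsI i) n)

theorem isAdicComplete (hconil : IsConilpotent γ) (hfin : IsFinitelyCogenerated γ) :
    IsAdicComplete (augIdeal γ) (DualAlgebra k C) where
  haus' f hf := eq_zero_of_forall_mem_pow hconil fun n => by
    have := SModEq.zero.1 (hf n)
    rwa [smul_eq_mul, Ideal.mul_top] at this
  prec' f hf := by
    have hf' {m n : ℕ} (h : m ≤ n) : f m - f n ∈ augIdeal γ ^ m := by
      have := SModEq.sub_mem.1 (hf h)
      rwa [smul_eq_mul, Ideal.mul_top] at this
    choose N hN using exists_mem_perp_pow hconil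
    have hstab {c : C} {n n' : ℕ} (hc : c ∈ perp (augIdeal γ ^ n)) (h : n ≤ n') :
        (f n).fn c = (f n').fn c := by
      rw [← sub_eq_zero, ← LinearMap.sub_apply, ← fn_sub]
      exact hc _ (hf' h)
    -- The limit is taken pointwise: on an element killed by Iⁿ the values of the sequence are
    -- constant from index n on.
    let L : C →ₗ[k] k :=
      { toFun c := (f (N c)).fn c
        map_add' c d := by
          let M := max (N (c + d)) (max (N c) (N d))
          rw [hstab (hN (c + d)) (n' := M) (by omega), hstab (hN c) (n' := M) (by omega),
            hstab (hN d) (n' := M) (by omega), map_add]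
        map_smul' a c := by
          let M := max (N (a • c)) (N c)
          rw [hstab (hN (a • c)) (n' := M) (by omega), hstab (hN c) (n' := M) (by omega),
            map_smul, RingHom.id_apply] }
    have hfg : (augIdeal γ).FG :=
      @IsNoetherian.noetherian _ _ _ _ _ (isNoetherianRing hconil hfin) (augIdeal γ)
    refine ⟨ofFn L, fun n => SModEq.sub_mem.2 ?_⟩
    rw [smul_eq_mul, Ideal.mul_top]
    -- Pointwise convergence becomes I-adic convergence because the powers of I are finitely
    -- generated, hence closed.
    refine mem_of_fg_of_perp hfg.pow fun c hc => ?_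
    let M := max n (N c)
    rw [fn_sub, LinearMap.sub_apply, sub_eq_zero, hstab hc (n' := M) (by omega)]
    exact (hstab (hN c) (n' := M) (by omega)).symm

theorem maximalIdeal_eq (hconil : IsConilpotent γ) :
    haveI := isLocalRing hconil
    IsLocalRing.maximalIdeal (DualAlgebra k C) = augIdeal γ :=
  haveI := isLocalRing hconil
  (IsLocalRing.eq_maximalIdeal augIdeal_isMaximal).symm

end DualAlgebra

theorem lift_isEquivalence_of_le_essImage {A B : Type*} [Category A] [Category B]
    (P : ObjectProperty B) (F : A ⥤ B) [F.Full] [F.Faithful] (h : ∀ X, P (F.obj X))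
    (hP : P ≤ F.essImage) : (P.lift F h).IsEquivalence where
  essSurj := ⟨fun Y => by
    obtain ⟨X, ⟨e⟩⟩ := hP _ Y.property
    exact ⟨X, ⟨P.isoMk e⟩⟩⟩

/-! ### Comodules and torsion modules -/

namespace DualAlgebra

variable {k C : Type u} [Field k] [AddCommGroup C] [Module k C] [Coalgebra k C]

theorem lid_rTensor_mul {M : Type*} [AddCommGroup M] [Module k M] (f g : DualAlgebra k C)
    (t : C ⊗[k] M) :
    TensorProduct.lid k M (LinearMap.rTensor M f.fn
      (TensorProduct.lid k (C ⊗[k] M) (LinearMap.rTensor (C ⊗[k] M) g.fn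
        (TensorProduct.assoc k C C M (LinearMap.rTensor M Coalgebra.comul t))))) =
    TensorProduct.lid k M (LinearMap.rTensor M (f * g).fn t) := by
  induction t using TensorProduct.induction_on with
  | zero => simp
  | add x y hx hy => simp only [map_add, hx, hy]
  | tmul c x =>
    rw [DualAlgebra.fn_mul]
    simp only [LinearMap.rTensor_tmul, LinearMap.comp_apply, TensorProduct.lid_tmul]
    generalize (Coalgebra.comul (R := k) c) = d
    induction d using TensorProduct.induction_on with
    | zero => simp
    | add a b ha hb => simp only [map_add, add_smul, TensorProduct.add_tmul, ha, hb]
    | tmul a b => simp [mul_smul]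

end DualAlgebra

namespace LeftComodule

open DualAlgebra

section

variable {k C : Type u} [Field k] [AddCommGroup C] [Module k C] [Coalgebra k C]

instance isScalarTower (M : LeftComodule k C) : IsScalarTower k (DualAlgebra k C) M.carrier where
  smul_assoc a f m := by
    rw [dual_smul_def, dual_smul_def, fn_smul, LinearMap.rTensor_smul, LinearMap.smul_apply,
      map_smul]

/-- The comodule structure on a module over the dual algebra on which the action comes from a
map to `C ⊗ M`. -/
theorem exists_of_forall_exists (M : Type u) [AddCommGroup M] [Module k M]
    [Module (DualAlgebra k C) M] [IsScalarTower k (DualAlgebra k C) M]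
    (h : ∀ m : M, ∃ t : C ⊗[k] M, ∀ f : DualAlgebra k C,
      TensorProduct.lid k M (LinearMap.rTensor M f.fn t) = f • m) :
    ∃ (N : LeftComodule k C) (e : N.carrier ≃+ M), ∀ (f : DualAlgebra k C) (x : N.carrier),
      e (f • x) = f • e x := by
  choose T hT using h
  have hT' (m : M) (f : C →ₗ[k] k) :
      TensorProduct.lid k M (LinearMap.rTensor M f (T m)) = ofFn f • m := hT m (ofFn f)
  -- Functionals on C separate C ⊗ M, so the chosen tensors are unique and depend linearly on m;
  -- coassociativity below follows from associativity of the action in the same way.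
  let ν : M →ₗ[k] C ⊗[k] M :=
    { toFun := T
      map_add' m n := eq_of_forall_lid_rTensor fun f => by
        rw [map_add, map_add, hT', hT', hT', smul_add]
      map_smul' a m := eq_of_forall_lid_rTensor fun f => by
        rw [RingHom.id_apply, map_smul, map_smul, hT', hT',
          ← algebraMap_smul (DualAlgebra k C) a m, ← algebraMap_smul (DualAlgebra k C) a,
          smul_smul, smul_smul, Algebra.commutes] }
  have hν (m : M) (f : DualAlgebra k C) :
      TensorProduct.lid k M (LinearMap.rTensor M f.fn (ν m)) = f • m := hT m f
  let N : LeftComodule k C :=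
    { carrier := M
      coact := ν
      coassoc := by
        refine LinearMap.ext fun m => eq_of_forall_lid_rTensor fun g =>
          eq_of_forall_lid_rTensor fun f => ?_
        rw [LinearMap.comp_apply, LinearMap.comp_apply, LinearMap.comp_apply, LinearEquiv.coe_coe,
          lid_rTensor_lTensor_apply]
        refine (lid_rTensor_mul (ofFn f) (ofFn g) (ν m)).trans ?_
        refine Eq.trans ?_ (hν _ (ofFn f)).symm
        rw [hν, mul_smul]
        exact congrArg _ (hν m (ofFn g)).symm
      counit_coact := by
        refine LinearMap.ext fun m => ?_
        have := hν m 1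
        rwa [one_smul, fn_one] at this }
  exact ⟨N, AddEquiv.refl M, fun f x => hν x f⟩

theorem eq_of_forall_smul {M : LeftComodule k C} {m : M.carrier} {t : C ⊗[k] M.carrier}
    (h : ∀ f : DualAlgebra k C,
      TensorProduct.lid k M.carrier (LinearMap.rTensor M.carrier f.fn t) = f • m) :
    t = M.coact m :=
  eq_of_forall_lid_rTensor fun f => h (ofFn f)

instance upsilon_faithful : (upsilon k C).Faithful where
  map_injective {M N f g} h := by
    refine linMap_injective (LinearMap.ext fun m => ?_)
    exact LinearMap.congr_fun (congrArg ModuleCat.Hom.hom h) m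

/-- The action determines the coaction, since functionals on C separate tensors; no finiteness is
involved. -/
instance upsilon_full : (upsilon k C).Full where
  map_surjective {M N} φ := by
    let f : M.carrier →ₗ[DualAlgebra k C] N.carrier := φ.hom
    let g : M.carrier →ₗ[k] N.carrier :=
      { toFun := f
        map_add' := map_add f
        map_smul' a m := by
          rw [← algebraMap_smul (DualAlgebra k C) a m, map_smul, algebraMap_smul]; rfl }
    refine ⟨(⟨g, LinearMap.ext fun m => ?_⟩ : Hom M N), rfl⟩
    refine (eq_of_forall_smul fun r => ?_).symm
    rw [LinearMap.comp_apply, lid_rTensor_lTensor_apply]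
    exact map_smul f r m

end

variable {k C : Type u} [Field k] [AddCommGroup C] [Module k C] [Coalgebra k C]
  [Coalgebra.IsCocomm k C] {γ : k →ₗc[k] C}

theorem exists_pow_smul_eq_zero (hconil : IsConilpotent γ) (M : LeftComodule k C)
    (m : M.carrier) : ∃ n, ∀ f ∈ augIdeal γ ^ n, f • m = 0 := by
  have key : ∀ t : C ⊗[k] M.carrier, ∃ n, ∀ f ∈ augIdeal γ ^ n,
      TensorProduct.lid k M.carrier (LinearMap.rTensor M.carrier f.fn t) = 0 := by
    intro t
    induction t using TensorProduct.induction_on with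
    | zero => exact ⟨0, fun f _ => by rw [map_zero, map_zero]⟩
    | add x y hx hy =>
      obtain ⟨a, ha⟩ := hx
      obtain ⟨b, hb⟩ := hy
      exact ⟨max a b, fun f hf => by
        rw [map_add, map_add, ha f (Ideal.pow_le_pow_right (le_max_left a b) hf),
          hb f (Ideal.pow_le_pow_right (le_max_right a b) hf), add_zero]⟩
    | tmul c x =>
      obtain ⟨n, hn⟩ := exists_mem_perp_pow hconil c
      exact ⟨n, fun f hf => by
        rw [LinearMap.rTensor_tmul, hn f hf, TensorProduct.zero_tmul, map_zero]⟩
  exact key (M.coact m)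

theorem isITorsion_upsilon (hconil : IsConilpotent γ) (M : LeftComodule k C) :
    IsITorsion (augIdeal γ) ((upsilon k C).obj M) := by
  intro s hs x
  obtain ⟨n, hn⟩ := exists_pow_smul_eq_zero hconil M x
  exact ⟨n + 1, n.succ_pos, hn _ (Ideal.pow_le_pow_right n.le_succ (Ideal.pow_mem_pow hs _))⟩

theorem perp_pow_fg (hconil : IsConilpotent γ) (hfin : IsFinitelyCogenerated γ) (n : ℕ) :
    (perp (augIdeal γ ^ n)).FG := by
  obtain ⟨m, s, hs, hdet⟩ := exists_detecting hconil hfin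
  induction n with
  | zero =>
    have : perp (augIdeal γ ^ 0) = ⊥ := by
      rw [Submodule.eq_bot_iff]
      intro c hc
      have h := act_eq_zero_of_mem_perp hc (r := 1) (by rw [pow_zero, Ideal.one_eq_top]; trivial)
      rwa [act_one] at h
    exact this ▸ Submodule.fg_bot
  | succ n ih =>
    -- The map c ↦ (sᵢ · c)ᵢ sends the annihilator of I^(n+1) to tuples killed by Iⁿ, and its kernel
    -- lies in the line γ(k).
    refine Submodule.fg_of_fg_map_of_fg_inf_ker (LinearMap.pi fun i => act (s i)) ?_ ?_
    · refine Submodule.FG.of_le (Submodule.fg_pi (p := fun _ : Fin m => _) fun _ => ih) ?_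
      rintro _ ⟨c, hc, rfl⟩ i -
      exact act_mem_perp hc (hs i)
    · refine Submodule.FG.of_le (Submodule.fg_span_singleton (γ 1)) ?_
      rintro c ⟨-, hc⟩
      rw [mem_perp_augIdeal.1 (hdet c fun i => congrFun hc i)]
      exact Submodule.smul_mem _ _ (Submodule.mem_span_singleton_self _)

/-- The tensor is ∑ bᵢ ⊗ gᵢm, for a basis bᵢ of the annihilator of Iⁿ and functionals gᵢ extending
the dual basis. It works because f - ∑ f(bᵢ)gᵢ vanishes on that annihilator and so lies in the
closed ideal Iⁿ. -/
theorem exists_tensor_of_pow_smul_eq_zero (hconil : IsConilpotent γ)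
    (hfin : IsFinitelyCogenerated γ) {M : Type*} [AddCommGroup M] [Module k M]
    [Module (DualAlgebra k C) M] [IsScalarTower k (DualAlgebra k C) M] {m : M} {n : ℕ}
    (hm : ∀ f ∈ augIdeal γ ^ n, f • m = 0) :
    ∃ t : C ⊗[k] M, ∀ f : DualAlgebra k C,
      TensorProduct.lid k M (LinearMap.rTensor M f.fn t) = f • m := by
  have : Module.Finite k (perp (augIdeal γ ^ n)) :=
    Module.Finite.iff_fg.2 (perp_pow_fg hconil hfin n)
  let b := Module.finBasis k (perp (augIdeal γ ^ n))
  choose g hg using fun i => LinearMap.exists_extend (b.coord i)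
  have hfg : (augIdeal γ ^ n).FG :=
    @IsNoetherian.noetherian _ _ _ _ _ (DualAlgebra.isNoetherianRing hconil hfin) (augIdeal γ ^ n)
  refine ⟨∑ i, (b i : C) ⊗ₜ[k] (ofFn (g i) • m), fun f => ?_⟩
  have hmem : f - ∑ i, f.fn (b i) • ofFn (g i) ∈ augIdeal γ ^ n := by
    refine mem_of_fg_of_perp hfg fun c hc => ?_
    rw [← counit_act, act_sub, act_sum, LinearMap.sub_apply, LinearMap.sum_apply, map_sub, map_sum]
    simp only [counit_act, fn_smul, LinearMap.smul_apply, fn_ofFn]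
    have h1 := congrArg (fun w : perp (augIdeal γ ^ n) => f.fn w) (b.sum_repr ⟨c, hc⟩)
    simp only [Submodule.coe_sum, Submodule.coe_smul, map_sum, map_smul] at h1
    rw [← h1, sub_eq_zero]
    refine Finset.sum_congr rfl fun i _ => ?_
    have h2 := LinearMap.congr_fun (hg i) ⟨c, hc⟩
    rw [LinearMap.comp_apply, Submodule.subtype_apply] at h2
    rw [h2, Module.Basis.coord_apply, smul_eq_mul, smul_eq_mul, mul_comm]
  have h0 := hm _ hmem
  rw [sub_smul, sub_eq_zero, Finset.sum_smul] at h0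
  rw [h0, map_sum, map_sum]
  refine Finset.sum_congr rfl fun i _ => ?_
  rw [LinearMap.rTensor_tmul, TensorProduct.lid_tmul, smul_assoc]

theorem essImage_upsilon (hconil : IsConilpotent γ) (hfin : IsFinitelyCogenerated γ) :
    (upsilon k C).essImage = IsITorsion (augIdeal γ) := by
  ext M
  constructor
  · rintro ⟨N, ⟨e⟩⟩ s hs x
    obtain ⟨n, hn, h⟩ := isITorsion_upsilon hconil N s hs (e.inv x)
    refine ⟨n, hn, ?_⟩
    have hx : e.hom (e.inv x) = x := LinearMap.congr_fun (congrArg ModuleCat.Hom.hom e.inv_hom_id) x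
    rw [← hx, ← map_smul e.hom.hom, h, map_zero]
  · intro hM
    let _ : Module k M := Module.compHom M (algebraMap k (DualAlgebra k C))
    have : IsScalarTower k (DualAlgebra k C) M := ⟨fun a f m =>
      (congrArg (· • m) (Algebra.smul_def a f)).trans (mul_smul _ f m)⟩
    have hfg : (augIdeal γ).FG :=
      @IsNoetherian.noetherian _ _ _ _ _ (DualAlgebra.isNoetherianRing hconil hfin) (augIdeal γ)
    obtain ⟨N, e, he⟩ := exists_of_forall_exists (k := k) (C := C) M fun m => by
      have hle : augIdeal γ ≤ (Ideal.torsionOf (DualAlgebra k C) M m).radical := fun s hs => by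
        obtain ⟨n, -, h⟩ := hM s hs m
        exact ⟨n, h⟩
      -- Torsion is given for one element of I at a time; finite generation of I yields a single
      -- power killing m.
      obtain ⟨n, hn⟩ := Ideal.exists_pow_le_of_le_radical_of_fg hle hfg
      exact exists_tensor_of_pow_smul_eq_zero hconil hfin (n := n) fun f hf => hn hf
    exact ⟨N, ⟨LinearEquiv.toModuleIso { e with map_smul' := he }⟩⟩

end LeftComodule

/-! ### Extending maps to free contramodules -/

namespace DualAlgebra

variable {k C : Type u} [Field k] [AddCommGroup C] [Module k C] [Coalgebra k C]

variable (k C) in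
/-- The element `c ↦ ε(c) v` of the free contramodule `Hom (C, V)`. -/
def constMap {V : Type*} [AddCommGroup V] [Module k V] (v : V) : C →ₗ[k] V :=
  (Coalgebra.counit (R := k) (A := C)).smulRight v

section

variable {V : Type*} [AddCommGroup V] [Module k V]

theorem constMap_apply (v : V) (c : C) :
    constMap k C v c = Coalgebra.counit (R := k) (A := C) c • v := rfl

theorem constMap_comp_act (v : V) (r : DualAlgebra k C) :
    constMap k C v ∘ₗ act r = r.fn.smulRight v := by
  ext c
  rw [LinearMap.comp_apply, constMap_apply, counit_act, LinearMap.smulRight_apply]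

theorem eq_constMap_add_sum {γ : k →ₗc[k] C} {m : ℕ} {s : Fin m → DualAlgebra k C} {ρ : Fin m → C →ₗ[k] C}
    (hρ : ∀ c, c = Coalgebra.counit (R := k) (A := C) c • γ 1 + ∑ i, ρ i (act (s i) c))
    (x : C →ₗ[k] V) : x = constMap k C (x (γ 1)) + ∑ i, (x ∘ₗ ρ i) ∘ₗ act (s i) := by
  ext c
  rw [LinearMap.add_apply, LinearMap.sum_apply, constMap_apply]
  conv_lhs => rw [hρ c, map_add, map_smul, map_sum]
  rfl

end

/-- Exactness of C → Cᵐ → Cˡ in the middle, by duality: a functional on Cᵐ that vanishes on the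
image of C is a syzygy of s, hence a combination of the σⱼ, hence kills c. -/
theorem exists_eq_act_of_syzygies {m l : ℕ} {s : Fin m → DualAlgebra k C}
    {σ : Fin l → Fin m → DualAlgebra k C}
    (hσ : ∀ f : Fin m → DualAlgebra k C, ∑ i, f i * s i = 0 →
      f ∈ Submodule.span (DualAlgebra k C) (Set.range σ))
    {c : Fin m → C} (hc : ∀ j, ∑ i, act (σ j i) (c i) = 0) :
    ∃ d, ∀ i, c i = act (s i) d := by
  by_contra hne
  have hnot : c ∉ LinearMap.range (LinearMap.pi fun i => act (s i)) := by
    rintro ⟨d, rfl⟩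
    exact hne ⟨d, fun i => rfl⟩
  obtain ⟨φ, hφc, hφ⟩ := Submodule.exists_le_ker_of_notMem hnot
  let f (i : Fin m) : DualAlgebra k C := ofFn (φ ∘ₗ LinearMap.single k (fun _ => C) i)
  have hφf (d : Fin m → C) : φ d = ∑ i, (f i).fn (d i) := by
    have e := congrArg φ (LinearMap.sum_single_apply (fun _ : Fin m => C) d)
    rw [map_sum] at e
    exact e.symm
  have hf := hσ f (fn_injective (LinearMap.ext fun d => by
    rw [← counit_act, act_sum_apply, map_sum]
    simp only [counit_act, ← fn_act]
    exact (hφf _).symm.trans (hφ ⟨d, rfl⟩)))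
  have key : ∀ g ∈ Submodule.span (DualAlgebra k C) (Set.range σ), ∑ i, act (g i) (c i) = 0 := by
    intro g hg
    induction hg using Submodule.span_induction with
    | mem x hx => obtain ⟨j, rfl⟩ := hx; exact hc j
    | zero => simp [act_zero]
    | add x y _ _ hx hy =>
      simp only [Pi.add_apply, act_add, LinearMap.add_apply, Finset.sum_add_distrib, hx, hy,
        add_zero]
    | smul a x _ hx =>
      simp only [Pi.smul_apply, smul_eq_mul, act_mul_apply, ← map_sum, hx, map_zero]
  apply hφc
  rw [hφf]
  simp only [← counit_act]
  rw [← map_sum, key f hf, map_zero]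

variable [Coalgebra.IsCocomm k C] {γ : k →ₗc[k] C}

/-- The projection of C onto ker ε along γ(1) vanishes on the common kernel of the sᵢ, so it factors
through c ↦ (sᵢ · c)ᵢ. -/
theorem exists_complement {m : ℕ} {s : Fin m → DualAlgebra k C}
    (hdet : ∀ c, (∀ i, act (s i) c = 0) → c ∈ perp (augIdeal γ)) :
    ∃ ρ : Fin m → C →ₗ[k] C,
      (∀ c, c = Coalgebra.counit (R := k) (A := C) c • γ 1 + ∑ i, ρ i (act (s i) c)) ∧
      ∀ i c, Coalgebra.counit (R := k) (A := C) (ρ i c) = 0 := by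
  let p : C →ₗ[k] C := LinearMap.id - constMap k C (γ 1)
  have hp (c : C) : p c = c - Coalgebra.counit (R := k) (A := C) c • γ 1 := rfl
  have hεp (c : C) : Coalgebra.counit (R := k) (A := C) (p c) = 0 := by
    rw [hp, map_sub, map_smul, counit_coaug, smul_eq_mul, mul_one, sub_self]
  obtain ⟨X, hX⟩ := exists_eq_sum_comp_of_ker_le (fun i => act (s i)) p fun c hc => by
    rw [hp, sub_eq_zero]
    exact mem_perp_augIdeal.1 (hdet c hc)
  -- Composing with the idempotent p keeps the factorization and places the values in ker ε, which
  -- makes constants v restrict to zero along ρ i.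
  refine ⟨fun i => p ∘ₗ X i, fun c => ?_, fun i c => hεp _⟩
  have h1 : p (p c) = p c := by rw [hp (p c), hεp, zero_smul, sub_zero]
  rw [← sub_eq_iff_eq_add', ← hp, ← h1]
  have h2 := congrArg p (LinearMap.congr_fun hX c)
  rw [LinearMap.sum_apply, map_sum] at h2
  exact h2

section

variable {V : Type*} [AddCommGroup V] [Module k V]

/-- An equivariant map out of `Hom (C, V)` is determined by its restriction to `V`. -/
theorem eq_of_eq_on_constMap (hconil : IsConilpotent γ) (hfin : IsFinitelyCogenerated γ)
    {P : Type*} [AddCommGroup P] [Module (DualAlgebra k C) P]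
    (hP : ∀ s ∈ augIdeal γ, Function.Bijective (telescope s P)) {h h' : (C →ₗ[k] V) →+ P}
    (hh : ∀ r x, h (x ∘ₗ act r) = r • h x) (hh' : ∀ r x, h' (x ∘ₗ act r) = r • h' x)
    (e : ∀ v, h (constMap k C v) = h' (constMap k C v)) (x : C →ₗ[k] V) : h x = h' x := by
  obtain ⟨m, s, hs, hdet⟩ := exists_detecting hconil hfin
  obtain ⟨ρ, hρ, -⟩ := exists_complement hdet
  rw [← sub_eq_zero]
  refine eq_zero_of_mem_span_smul_span (s := s) (β := fun x => h x - h' x) (fun i => hP _ (hs i))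
    (fun x => ?_) x
  have hx := eq_constMap_add_sum hρ x
  -- The constant parts cancel, leaving an I-combination of the same differences at x ∘ ρᵢ.
  have key : h x - h' x = ∑ i, s i • (h (x ∘ₗ ρ i) - h' (x ∘ₗ ρ i)) := by
    conv_lhs => rw [hx, map_add, map_add, map_sum, map_sum, e, add_sub_add_left_eq_sub,
      ← Finset.sum_sub_distrib]
    exact Finset.sum_congr rfl fun i _ => by rw [hh, hh', smul_sub]
  rw [key]
  exact Submodule.sum_mem _ fun i _ => Submodule.smul_mem_smul (Ideal.subset_span ⟨i, rfl⟩)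
    (Submodule.subset_span ⟨x ∘ₗ ρ i, rfl⟩)

end

/-- Noetherianity makes the syzygy module finitely generated. A relation ∑ zᵢ ∘ act sᵢ = 0 says that
z vanishes on the image of C in Cᵐ, which contains the kernel of Cᵐ → Cˡ, so z factors through Cˡ.
-/
theorem exists_syzygies (hconil : IsConilpotent γ) (hfin : IsFinitelyCogenerated γ) {m : ℕ}
    (s : Fin m → DualAlgebra k C) :
    ∃ (l : ℕ) (σ : Fin l → Fin m → DualAlgebra k C), (∀ j, ∑ i, σ j i * s i = 0) ∧
      ∀ {V : Type u} [AddCommGroup V] [Module k V] (z : Fin m → C →ₗ[k] V),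
        ∑ i, z i ∘ₗ act (s i) = 0 →
        ∃ w : Fin l → C →ₗ[k] V, ∀ i, z i = ∑ j, w j ∘ₗ act (σ j i) := by
  have := isNoetherianRing hconil hfin
  let T : (Fin m → DualAlgebra k C) →ₗ[DualAlgebra k C] DualAlgebra k C :=
    Fintype.linearCombination (DualAlgebra k C) s
  obtain ⟨l, σ, hσ⟩ := Submodule.fg_iff_exists_fin_generating_family.1
    (IsNoetherian.noetherian (LinearMap.ker T))
  refine ⟨l, σ, fun j => ?_, fun {V} _ _ z hz => ?_⟩
  · have : σ j ∈ LinearMap.ker T := hσ ▸ Submodule.subset_span ⟨j, rfl⟩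
    exact this
  · obtain ⟨w, hw⟩ := exists_eq_sum_comp_of_ker_le
      (fun j => ∑ i, act (σ j i) ∘ₗ LinearMap.proj (R := k) (φ := fun _ : Fin m => C) i)
      (∑ i, z i ∘ₗ LinearMap.proj (R := k) (φ := fun _ : Fin m => C) i) fun c hc => by
        obtain ⟨d, hd⟩ := exists_eq_act_of_syzygies (s := s) (σ := σ) (c := c)
          (fun f hf => hσ ▸ LinearMap.mem_ker.2 hf)
          (fun j => by simpa [LinearMap.sum_apply] using hc j)
        have := LinearMap.congr_fun hz d
        simpa [LinearMap.sum_apply, hd] using this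
    refine ⟨w, fun i => ?_⟩
    ext c
    have := LinearMap.congr_fun hw (Pi.single i c)
    simp only [LinearMap.sum_apply, LinearMap.comp_apply, LinearMap.proj_apply, map_sum] at this
    rw [Finset.sum_eq_single i (by
      intro b _ hb; rw [Pi.single_eq_of_ne hb, map_zero]) (by simp), Pi.single_eq_same] at this
    rw [this, LinearMap.sum_apply]
    refine Finset.sum_congr rfl fun j _ => ?_
    rw [Finset.sum_eq_single i (by
      intro b _ hb; rw [Pi.single_eq_of_ne hb, map_zero, map_zero]) (by simp), Pi.single_eq_same]
    rfl

end DualAlgebra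

/-! ### Existence of equivariant extensions -/

namespace DualAlgebra

variable {k C : Type u} [Field k] [AddCommGroup C] [Module k C] [Coalgebra k C]

variable [Coalgebra.IsCocomm k C] {γ : k →ₗc[k] C}

/-- Maps from `V` to a contramodule over the augmentation ideal extend to equivariant maps out of
`Hom (C, V)`. -/
theorem exists_extension (hconil : IsConilpotent γ) (hfin : IsFinitelyCogenerated γ)
    {V P : Type u} [AddCommGroup V] [Module k V] [AddCommGroup P] [Module k P]
    [Module (DualAlgebra k C) P] [IsScalarTower k (DualAlgebra k C) P]
    (hP : ∀ s ∈ augIdeal γ, Function.Bijective (telescope s P)) (α : V →ₗ[k] P) :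
    ∃ h : (C →ₗ[k] V) →+ P, (∀ r x, h (x ∘ₗ act r) = r • h x) ∧
      ∀ v, h (constMap k C v) = α v := by
  obtain ⟨m, s, hs, hdet⟩ := exists_detecting hconil hfin
  have hspan : augIdeal γ ≤ Ideal.span (Set.range s) := fun f hf =>
    mem_span_range_of_perp fun c hc =>
      hdet c (fun i => act_eq_zero_of_mem_perp hc (Ideal.subset_span ⟨i, rfl⟩)) f hf
  have hT (i : Fin m) := hP _ (hs i)
  have hsI (i : Fin m) : s i ∈ Ideal.span (Set.range s) := Ideal.subset_span ⟨i, rfl⟩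
  obtain ⟨ρ, hρ, hερ⟩ := exists_complement hdet
  obtain ⟨l, σ, hσ, hsyz⟩ := exists_syzygies hconil hfin s
  -- Solve the recursion in the module of all functions Hom(C, V) → P, with x ↦ x ∘ ρᵢ as self-maps
  -- of the index set; no linearity is known yet.
  obtain ⟨h₀, hh₀⟩ := (one_sub_sum_smul_bijective Finset.univ
    (fun i => telescope_pi_bijective (hT i) (C →ₗ[k] V))
    (fun i => LinearMap.funLeft (DualAlgebra k C) P
      (fun x : C →ₗ[k] V => x ∘ₗ ρ i))).2 fun x => α (x (γ 1))
  have hrec₀ (x : C →ₗ[k] V) : h₀ x = α (x (γ 1)) + ∑ i, s i • h₀ (x ∘ₗ ρ i) := by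
    have := congrFun hh₀ x
    rw [LinearMap.sub_apply, Pi.sub_apply, sub_eq_iff_eq_add] at this
    rw [Module.End.one_apply] at this
    rw [this]
    simp [LinearMap.funLeft_apply]
  have hadd (x y : C →ₗ[k] V) : h₀ (x + y) - h₀ x - h₀ y = 0 := by
    refine eq_zero_of_mem_span_smul_span hT
      (β := fun z : (C →ₗ[k] V) × (C →ₗ[k] V) => h₀ (z.1 + z.2) - h₀ z.1 - h₀ z.2)
      (fun z => ?_) (x, y)
    have e : h₀ (z.1 + z.2) - h₀ z.1 - h₀ z.2 = ∑ i, s i •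
        (h₀ (z.1 ∘ₗ ρ i + z.2 ∘ₗ ρ i) - h₀ (z.1 ∘ₗ ρ i) - h₀ (z.2 ∘ₗ ρ i)) := by
      rw [hrec₀ (z.1 + z.2), hrec₀ z.1, hrec₀ z.2, LinearMap.add_apply, map_add]
      simp only [smul_sub, Finset.sum_sub_distrib, LinearMap.add_comp]
      abel
    rw [e]
    exact Submodule.sum_mem _ fun i _ => Submodule.smul_mem_smul (hsI i)
      (Submodule.subset_span ⟨(z.1 ∘ₗ ρ i, z.2 ∘ₗ ρ i), rfl⟩)
  let h : (C →ₗ[k] V) →+ P := AddMonoidHom.mk' h₀ fun x y => by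
    have := hadd x y
    rwa [sub_sub, sub_eq_zero] at this
  have hrec (x : C →ₗ[k] V) : h x = α (x (γ 1)) + ∑ i, s i • h (x ∘ₗ ρ i) := hrec₀ x
  have hconst (v : V) : h (constMap k C v) = α v := by
    rw [hrec, constMap_apply, counit_coaug, one_smul, add_eq_left]
    refine Finset.sum_eq_zero fun i _ => ?_
    have : constMap k C v ∘ₗ ρ i = 0 := by
      ext c
      rw [LinearMap.comp_apply, constMap_apply, hερ, zero_smul, LinearMap.zero_apply]
    rw [this, map_zero, smul_zero]
  -- D is the defect of equivariance; the aim is to show that every value of D lies in N = I ·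
  -- span(D).
  let D : DualAlgebra k C × (C →ₗ[k] V) → P := fun z => h (z.2 ∘ₗ act z.1) - z.1 • h z.2
  have hD (r : DualAlgebra k C) (x : C →ₗ[k] V) : h (x ∘ₗ act r) = D (r, x) + r • h x := by
    simp only [D, sub_add_cancel]
  let N := Ideal.span (Set.range s) • Submodule.span (DualAlgebra k C) (Set.range D)
  have hDN (i : Fin m) (z) : s i • D z ∈ N :=
    Submodule.smul_mem_smul (hsI i) (Submodule.subset_span ⟨z, rfl⟩)
  -- Modulo N the recursion holds for every decomposition of x, not just the one given by ρ: two
  -- decompositions differ by a combination of syzygies σⱼ, and ∑ σⱼᵢsᵢ = 0 leaves only defects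
  -- multiplied by the sᵢ.
  have hdecomp (x : C →ₗ[k] V) (y : Fin m → C →ₗ[k] V)
      (hxy : x = constMap k C (x (γ 1)) + ∑ i, y i ∘ₗ act (s i)) :
      h x - (α (x (γ 1)) + ∑ i, s i • h (y i)) ∈ N := by
    obtain ⟨w, hw⟩ := hsyz (fun i => x ∘ₗ ρ i - y i) (by
      have e := (eq_constMap_add_sum hρ x).symm.trans hxy
      simp only [LinearMap.sub_comp, Finset.sum_sub_distrib]
      rw [sub_eq_zero]
      exact add_left_cancel e)
    have e : h x - (α (x (γ 1)) + ∑ i, s i • h (y i)) = ∑ i, ∑ j, s i • D (σ j i, w j) := by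
      have e1 (i : Fin m) : s i • h (x ∘ₗ ρ i) - s i • h (y i) =
          ∑ j, s i • D (σ j i, w j) + ∑ j, (σ j i * s i) • h (w j) := by
        rw [← smul_sub, ← map_sub, hw i, map_sum, ← Finset.sum_add_distrib, Finset.smul_sum]
        refine Finset.sum_congr rfl fun j _ => ?_
        rw [hD, smul_add, smul_smul, mul_comm]
      rw [hrec x, add_sub_add_left_eq_sub, ← Finset.sum_sub_distrib,
        Finset.sum_congr rfl fun i _ => e1 i, Finset.sum_add_distrib, add_eq_left,
        Finset.sum_comm]
      refine Finset.sum_eq_zero fun j _ => ?_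
      rw [← Finset.sum_smul, hσ]
      exact zero_smul (DualAlgebra k C) (h (w j))
    rw [e]
    exact Submodule.sum_mem _ fun i _ => Submodule.sum_mem _ fun j _ => hDN i _
  refine ⟨h, fun r x => ?_, hconst⟩
  rw [← sub_eq_zero]
  refine eq_zero_of_mem_span_smul_span hT (β := D) (fun ⟨r, x⟩ => ?_) (r, x)
  obtain ⟨c, hc⟩ := Ideal.mem_span_range_iff_exists_fun.1 (hspan (sub_algebraMap_mem (γ := γ) r))
  have hr : r = algebraMap k _ (r.fn (γ 1)) + ∑ i, c i * s i := by rw [hc]; abel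
  set v := x (γ 1) with hv
  have hval : (x ∘ₗ act r) (γ 1) = r.fn (γ 1) • v := by
    rw [LinearMap.comp_apply, act_coaug, map_smul]
  -- A second decomposition of x ∘ act r: expand x by ρ, then expand r on the constant term v using
  -- r = r(γ1) + ∑ cᵢsᵢ.
  have hmem := hdecomp (x ∘ₗ act r)
    (fun i => constMap k C v ∘ₗ act (c i) + (x ∘ₗ ρ i) ∘ₗ act r) (by
      ext d
      rw [hval, LinearMap.add_apply, LinearMap.sum_apply, constMap_apply, LinearMap.comp_apply]
      conv_lhs => rw [eq_constMap_add_sum hρ x, LinearMap.add_apply, constMap_apply, counit_act,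
        ← hv, LinearMap.sum_apply]
      have e1 : r.fn d • v = Coalgebra.counit (R := k) (A := C) d • r.fn (γ 1) • v +
          ∑ i, constMap k C v (act (c i) (act (s i) d)) := by
        have := congrArg (fun f => f.fn d) hr
        beta_reduce at this
        rw [this, ← counit_act, act_add, LinearMap.add_apply, act_algebraMap, act_sum_apply,
          map_add, map_smul, map_sum, add_smul, Finset.sum_smul, smul_smul, smul_eq_mul, mul_comm]
        congr 1
        refine Finset.sum_congr rfl fun i _ => ?_
        rw [act_mul_apply, constMap_apply]
      rw [e1, add_assoc, ← Finset.sum_add_distrib]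
      congr 1
      refine Finset.sum_congr rfl fun i _ => ?_
      rw [LinearMap.comp_apply, LinearMap.comp_apply, act_comm (s i) r]
      rfl)
  -- The main terms in this decomposition add up to r • h x, so what remains of D(r, x) is an
  -- element of N.
  have hfinal : D (r, x) = (h (x ∘ₗ act r) - (α ((x ∘ₗ act r) (γ 1)) +
      ∑ i, s i • h (constMap k C v ∘ₗ act (c i) + (x ∘ₗ ρ i) ∘ₗ act r))) +
      ∑ i, (s i • D (c i, constMap k C v) + s i • D (r, x ∘ₗ ρ i)) := by
    have e1 : ∑ i, s i • h (constMap k C v ∘ₗ act (c i) + (x ∘ₗ ρ i) ∘ₗ act r) =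
        ∑ i, (s i • D (c i, constMap k C v) + s i • D (r, x ∘ₗ ρ i)) +
          ((∑ i, c i * s i) • α v + r • ∑ i, s i • h (x ∘ₗ ρ i)) := by
      rw [Finset.sum_smul, Finset.smul_sum, ← Finset.sum_add_distrib, ← Finset.sum_add_distrib]
      refine Finset.sum_congr rfl fun i _ => ?_
      rw [map_add, hD, hD, hconst, smul_add, smul_add, smul_add, smul_smul, smul_smul, smul_smul,
        mul_comm (s i) (c i), mul_comm (s i) r]
      abel
    have e2 : r • h x = r.fn (γ 1) • α v + ((∑ i, c i * s i) • α v +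
        r • ∑ i, s i • h (x ∘ₗ ρ i)) := by
      rw [hrec x, smul_add, ← add_assoc, ← algebraMap_smul (DualAlgebra k C) (r.fn (γ 1)) (α v),
        ← add_smul, ← hr]
    rw [e1, hval, map_smul]
    simp only [D]
    rw [e2]
    abel
  rw [hfinal]
  exact N.add_mem hmem (Submodule.sum_mem _ fun i _ => N.add_mem (hDN i _) (hDN i _))

end DualAlgebra

theorem telescope_bijective_of_linearEquiv {R M N : Type*} [CommRing R] [AddCommGroup M]
    [Module R M] [AddCommGroup N] [Module R N] (e : M ≃ₗ[R] N) {s : R}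
    (h : Function.Bijective (telescope s M)) : Function.Bijective (telescope s N) := by
  let E : (ℕ → M) ≃ₗ[R] (ℕ → N) := LinearEquiv.piCongrRight fun _ => e
  have hE : telescope s N ∘ E = E ∘ telescope s M := by
    ext q n
    change e (q n) - s • e (q (n + 1)) = e (q n - s • q (n + 1))
    rw [map_sub, map_smul]
  rw [← Function.Bijective.of_comp_iff _ E.bijective, hE]
  exact E.bijective.comp h

/-! ### Contramodules -/

namespace LeftContramodule

open DualAlgebra

variable {k C : Type u} [Field k] [AddCommGroup C] [Module k C] [Coalgebra k C]

instance isScalarTower (P : LeftContramodule k C) :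
    IsScalarTower k (DualAlgebra k C) P.carrier where
  smul_assoc a f p := by
    rw [dual_smul_def, dual_smul_def, fn_smul, ← map_smul]
    congr 1
    ext c
    simp [mul_smul]

/-- The multiplication of the monad `Hom (C, -)`. -/
def monadMul {V : Type*} [AddCommGroup V] [Module k V] :
    (C →ₗ[k] C →ₗ[k] V) →ₗ[k] C →ₗ[k] V where
  toFun Y := TensorProduct.lift Y.flip ∘ₗ Coalgebra.comul
  map_add' Y Z := by
    rw [← LinearMap.add_comp]
    congr 1
    ext; simp
  map_smul' a Y := by
    rw [RingHom.id_apply, ← LinearMap.smul_comp]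
    congr 1
    ext; simp

section

variable {V : Type*} [AddCommGroup V] [Module k V]

theorem monadMul_apply (Y : C →ₗ[k] C →ₗ[k] V) (c : C) :
    monadMul Y c = TensorProduct.lift Y.flip (Coalgebra.comul c) := rfl

theorem monadMul_curry_flip (g : C ⊗[k] C →ₗ[k] V) :
    monadMul (TensorProduct.curry g).flip = g ∘ₗ Coalgebra.comul := by
  have e : TensorProduct.lift (TensorProduct.curry g) = g := by ext; simp
  ext c
  rw [monadMul_apply, LinearMap.flip_flip, e]
  rfl

theorem monadMul_constMap (x : C →ₗ[k] V) : monadMul (constMap k C x) = x := by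
  ext c
  have e : TensorProduct.lift (constMap k C x).flip = x ∘ₗ (TensorProduct.rid k C).toLinearMap ∘ₗ
      LinearMap.lTensor C Coalgebra.counit := by
    ext c d
    simp [constMap_apply]
  rw [monadMul_apply, e, LinearMap.comp_apply, LinearMap.comp_apply,
    Coalgebra.lTensor_counit_comul]
  simp

theorem monadMul_comp_act [Coalgebra.IsCocomm k C] (Y : C →ₗ[k] C →ₗ[k] V)
    (r : DualAlgebra k C) : monadMul (Y ∘ₗ act r) = monadMul Y ∘ₗ act r := by
  ext c
  rw [LinearMap.comp_apply, monadMul_apply, monadMul_apply, comul_act]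
  generalize (Coalgebra.comul (R := k) c) = d
  induction d using TensorProduct.induction_on with
  | zero => simp
  | add x y hx hy => simp only [map_add, hx, hy]
  | tmul x y => simp

end

/-- Contraassociativity in the form of an algebra over the monad Hom(C, -). -/
theorem contra_comp (P : LeftContramodule k C) (Y : C →ₗ[k] C →ₗ[k] P.carrier) :
    P.contra (P.contra ∘ₗ Y) = P.contra (monadMul Y) := by
  have h := P.contraassoc (TensorProduct.lift Y.flip)
  have e : (TensorProduct.curry (TensorProduct.lift Y.flip)).flip = Y := by
    ext; simp
  rw [e] at h
  exact h

theorem contra_constMap (P : LeftContramodule k C) (p : P.carrier) :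
    P.contra (constMap k C p) = p := P.contraunit p

instance theta_faithful : (theta k C).Faithful where
  map_injective {P Q f g} h := by
    refine Hom.ext (LinearMap.ext fun p => ?_)
    exact LinearMap.congr_fun (congrArg ModuleCat.Hom.hom h) p

variable [Coalgebra.IsCocomm k C] {γ : k →ₗc[k] C}

/-- Apply contraassociativity to r times the constant family x: multiplying out in the monad gives x
∘ act r, while contracting the inner variable first gives r • π(x). -/
theorem contra_comp_act (P : LeftContramodule k C) (r : DualAlgebra k C)
    (x : C →ₗ[k] P.carrier) : P.contra (x ∘ₗ act r) = r • P.contra x := by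
  have h := P.contra_comp (constMap k C x ∘ₗ act r)
  rw [monadMul_comp_act, monadMul_constMap] at h
  rw [← h, dual_smul_def]
  congr 1
  rw [constMap_comp_act]
  ext c
  simp

/-- The equation is solved in Hom(C, P) and pushed forward by π. For injectivity, constant lifts
satisfy it only up to xₙ in ker π, so one needs a solution Z for the xₙ that stays in ker π. -/
theorem telescope_bijective (hconil : IsConilpotent γ) (P : LeftContramodule k C)
    {s : DualAlgebra k C} (hs : s ∈ augIdeal γ) :
    Function.Bijective (telescope s P.carrier) := by
  constructor
  · rw [injective_iff_map_eq_zero]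
    intro q hq
    have hq' (n : ℕ) : q n - s • q (n + 1) = 0 := congrFun hq n
    let x (n : ℕ) : C →ₗ[k] P.carrier := constMap k C (q n) - constMap k C (q (n + 1)) ∘ₗ act s
    have hx (n : ℕ) : P.contra (x n) = 0 := by
      rw [map_sub, contra_comp_act, contra_constMap, contra_constMap, hq']
    obtain ⟨Y, hY⟩ := exists_eq_add_comp_act hconil hs fun n => constMap k C (x n)
    -- Solve one level up, in Hom(C, Hom(C, P)), and take the difference of the two maps to Hom(C,
    -- P) that π equalizes: then π(Zₙ) = 0, and Z solves the equation for x because π ∘ const(xₙ) =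
    -- 0.
    let Z (n : ℕ) : C →ₗ[k] P.carrier := monadMul (Y n) - P.contra ∘ₗ Y n
    have hZ (n : ℕ) : Z n - Z (n + 1) ∘ₗ act s = x n := by
      have h1 := congrArg monadMul (hY n)
      rw [map_sub, monadMul_comp_act, monadMul_constMap] at h1
      have h2 := congrArg (fun y => P.contra ∘ₗ y) (hY n)
      have h3 : P.contra ∘ₗ constMap k C (x n) = 0 := by
        ext c
        rw [LinearMap.comp_apply, constMap_apply, map_smul, hx, smul_zero, LinearMap.zero_apply]
      beta_reduce at h2
      rw [h3, LinearMap.comp_sub, ← LinearMap.comp_assoc] at h2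
      rw [← h1, ← sub_zero (monadMul (Y n) - _), ← h2]
      simp only [Z, LinearMap.sub_comp]
      abel
    -- Homogeneous solutions in Hom(C, P) vanish, so the constant qₙ equals Zₙ; applying π gives qₙ
    -- = 0.
    have hX := eq_zero_of_eq_comp_act hconil hs (z := fun n => constMap k C (q n) - Z n)
      fun n => by
        have := hZ n
        simp only [x] at this
        rw [LinearMap.sub_comp, sub_eq_sub_iff_sub_eq_sub]
        exact this.symm
    ext n
    rw [← P.contra_constMap (q n), sub_eq_zero.1 (hX n), map_sub, contra_comp, sub_self]
    rfl
  · intro a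
    obtain ⟨q, hq⟩ := exists_eq_add_comp_act hconil hs fun n => constMap k C (a n)
    refine ⟨fun n => P.contra (q n), funext fun n => ?_⟩
    rw [telescope_apply, ← contra_comp_act, ← map_sub, hq, contra_constMap]

theorem isIContramodule_theta (hconil : IsConilpotent γ) (P : LeftContramodule k C) :
    IsIContramodule (augIdeal γ) ((theta k C).obj P) :=
  (isIContramodule_iff _ _).2 fun _ hs => telescope_bijective hconil P hs

/-- Both g ∘ π and π ∘ Hom(C, g) are equivariant maps Hom(C, P) → Q restricting to g on constants,
so uniqueness of extensions identifies them. -/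
theorem theta_full (hconil : IsConilpotent γ) (hfin : IsFinitelyCogenerated γ) :
    (theta k C).Full where
  map_surjective {P Q} φ := by
    let f : P.carrier →ₗ[DualAlgebra k C] Q.carrier := φ.hom
    let g : P.carrier →ₗ[k] Q.carrier :=
      { toFun := f
        map_add' := map_add f
        map_smul' a m := by
          rw [← algebraMap_smul (DualAlgebra k C) a m, map_smul, algebraMap_smul]; rfl }
    refine ⟨(⟨g, fun x => ?_⟩ : Hom P Q), rfl⟩
    refine eq_of_eq_on_constMap hconil hfin (fun s hs => telescope_bijective hconil Q hs)
      (h := (g ∘ₗ P.contra).toAddMonoidHom)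
      (h' := (Q.contra ∘ₗ LinearMap.compRight k g).toAddMonoidHom) (fun r x => ?_) (fun r x => ?_)
      (fun p => ?_) x
    · change f (P.contra (x ∘ₗ act r)) = r • f (P.contra x)
      rw [contra_comp_act, map_smul]
    · exact contra_comp_act Q r (g ∘ₗ x)
    · change g (P.contra (constMap k C p)) = Q.contra (g ∘ₗ constMap k C p)
      have e : g ∘ₗ constMap k C p = constMap k C (g p) := by
        ext c
        rw [LinearMap.comp_apply, constMap_apply, constMap_apply, map_smul]
      rw [e, contra_constMap, contra_constMap]

/-- The contramodule structure on a contramodule over the augmentation ideal. -/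
theorem exists_of_telescope_bijective (hconil : IsConilpotent γ) (hfin : IsFinitelyCogenerated γ)
    (P : Type u) [AddCommGroup P] [Module k P] [Module (DualAlgebra k C) P]
    [IsScalarTower k (DualAlgebra k C) P]
    (hP : ∀ s ∈ augIdeal γ, Function.Bijective (telescope s P)) :
    ∃ (Q : LeftContramodule k C) (e : Q.carrier ≃+ P), ∀ (f : DualAlgebra k C) (x : Q.carrier),
      e (f • x) = f • e x := by
  obtain ⟨h, hact, hconst⟩ := exists_extension hconil hfin hP (LinearMap.id (R := k) (M := P))
  let π : (C →ₗ[k] P) →ₗ[k] P :=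
    { toFun := h
      map_add' := map_add h
      -- Scalars of k act through the dual algebra, so k-linearity is a special case of
      -- equivariance.
      map_smul' a x := by
        have e : a • x = x ∘ₗ act (algebraMap k (DualAlgebra k C) a) := by
          ext c
          rw [LinearMap.comp_apply, act_algebraMap, map_smul, LinearMap.smul_apply]
        rw [e, hact, algebraMap_smul, RingHom.id_apply] }
  -- Uniqueness of extensions is applied with V = Hom(C, P): both sides are equivariant in Y and
  -- equal π(x) on the constant Y with value x.
  have hassoc (Y : C →ₗ[k] C →ₗ[k] P) : π (π ∘ₗ Y) = π (monadMul Y) := by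
    refine eq_of_eq_on_constMap hconil hfin hP
      (h := (π ∘ₗ LinearMap.compRight k π).toAddMonoidHom)
      (h' := (π ∘ₗ monadMul).toAddMonoidHom) (fun r Y => ?_) (fun r Y => ?_) (fun x => ?_) Y
    · exact hact r (π ∘ₗ Y)
    · change h (monadMul (Y ∘ₗ act r)) = r • h (monadMul Y)
      rw [monadMul_comp_act, hact]
    · change π (π ∘ₗ constMap k C x) = π (monadMul (constMap k C x))
      have e : π ∘ₗ constMap k C x = constMap k C (π x) := by
        ext c
        rw [LinearMap.comp_apply, constMap_apply, constMap_apply, map_smul]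
      rw [e, monadMul_constMap]
      exact hconst _
  let Q : LeftContramodule k C :=
    { carrier := P
      contra := π
      contraassoc := fun g => by rw [hassoc, monadMul_curry_flip]
      contraunit := hconst }
  refine ⟨Q, AddEquiv.refl P, fun f (x : P) => ?_⟩
  change h (f.fn.smulRight x) = f • x
  rw [← constMap_comp_act, hact, hconst]
  rfl

theorem essImage_theta (hconil : IsConilpotent γ) (hfin : IsFinitelyCogenerated γ) :
    (theta k C).essImage = IsIContramodule (augIdeal γ) := by
  ext M
  rw [isIContramodule_iff]
  constructor
  · rintro ⟨P, ⟨e⟩⟩ s hs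
    exact telescope_bijective_of_linearEquiv e.toLinearEquiv (telescope_bijective hconil P hs)
  · intro hM
    let _ : Module k M := Module.compHom M (algebraMap k (DualAlgebra k C))
    have : IsScalarTower k (DualAlgebra k C) M := ⟨fun a f m =>
      (congrArg (· • m) (Algebra.smul_def a f)).trans (mul_smul _ f m)⟩
    obtain ⟨P, e, he⟩ := exists_of_telescope_bijective hconil hfin M hM
    exact ⟨P, ⟨LinearEquiv.toModuleIso { e with map_smul' := he }⟩⟩

end LeftContramodule

theorem mainTheorem11 {k C : Type u} [Field k] [AddCommGroup C] [Module k C] [Coalgebra k C]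
    [Coalgebra.IsCocomm k C] (γ : k →ₗc[k] C) (hconil : IsConilpotent γ)
    (hfin : IsFinitelyCogenerated γ) :
    ∃ _ : IsLocalRing (DualAlgebra k C),
      IsNoetherianRing (DualAlgebra k C) ∧
      IsAdicComplete (IsLocalRing.maximalIdeal (DualAlgebra k C)) (DualAlgebra k C) ∧
      ((LeftComodule.upsilon k C).essImage =
          IsITorsion (IsLocalRing.maximalIdeal (DualAlgebra k C)) ∧
        ∃ h : ∀ M : LeftComodule k C,
            IsITorsion (IsLocalRing.maximalIdeal (DualAlgebra k C))
              ((LeftComodule.upsilon k C).obj M),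
          ((IsITorsion (IsLocalRing.maximalIdeal (DualAlgebra k C))).lift
            (LeftComodule.upsilon k C) h).IsEquivalence) ∧
      ((LeftContramodule.theta k C).Full ∧ (LeftContramodule.theta k C).Faithful ∧
        (LeftContramodule.theta k C).essImage =
          IsIContramodule (IsLocalRing.maximalIdeal (DualAlgebra k C)) ∧
        ∃ h : ∀ P : LeftContramodule k C,
            IsIContramodule (IsLocalRing.maximalIdeal (DualAlgebra k C))
              ((LeftContramodule.theta k C).obj P),
          ((IsIContramodule (IsLocalRing.maximalIdeal (DualAlgebra k C))).lift
            (LeftContramodule.theta k C) h).IsEquivalence) := by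
  have hloc := DualAlgebra.isLocalRing hconil
  have hmax : IsLocalRing.maximalIdeal (DualAlgebra k C) = DualAlgebra.augIdeal γ :=
    DualAlgebra.maximalIdeal_eq hconil
  have htors := LeftComodule.essImage_upsilon hconil hfin
  have hctra := LeftContramodule.essImage_theta hconil hfin
  have hfull := LeftContramodule.theta_full hconil hfin
  refine ⟨hloc, DualAlgebra.isNoetherianRing hconil hfin, ?_⟩
  rw [hmax]
  exact ⟨DualAlgebra.isAdicComplete hconil hfin,
    ⟨htors, LeftComodule.isITorsion_upsilon hconil,
      lift_isEquivalence_of_le_essImage _ _ _ htors.ge⟩,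
    hfull, inferInstance, hctra, LeftContramodule.isIContramodule_theta hconil,
      lift_isEquivalence_of_le_essImage _ _ _ hctra.ge⟩
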